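/- **Setting.** Let $V$ be a finite-dimensional real vector space, $I$ a finite set, $(\alpha_i)_{i\in I}$ a linearly independent family in $V^*$ and $(\alpha_i^\vee)_{i\in I}$ a family in $V$ with $\alpha_i(\alpha_i^\vee)=2$. Put $r_i(v)=v-\alpha_i(v)\alpha_i^\vee$, let $W^v\subset GL(V)$ be the group generated by the $r_i$, and let $\Phi=\{w\alpha_i\}$ be the set of real roots, $\Phi^+=\Phi\cap\bigoplus_i\mathbb R_{\ge0}\alpha_i$. Assume the usual properties: $W^v$ is a Coxeter group with generators $r_i$ and Coxeter matrix $(\mathrm{ord}(r_ir_j))_{i,j}$; $r_\alpha:=wr_iw^{-1}$ depends only on $\alpha=w\alpha_i$; $\Phi=\Phi^+\sqcup-\Phi^+$; only $1\in W^v$ stabilizes $\Phi^+$; $w\alpha_i\in\Phi^+\Leftrightarrow\ell(wr_i)>\ell(w)$; and $\Phi\cap\mathbb R_{\ge0}\alpha=\{\alpha\}$ for $\alpha\in\Phi$. Let $\Delta_{im}\subset V^*\setminus\{0\}$ be a set of imaginary roots, disjoint from $\mathbb R\Phi$, stable under $\pm W^v$ and moderately imaginary: $\Delta_{im}=\Delta_{im}^+\cup-\Delta_{im}^+$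 with $\Delta_{im}^+=\Delta_{im}\cap\bigoplus_i\mathbb R_{\ge0}\alpha_i$ stable under $W^v$. Put $\Delta=\Phi\cup\Delta_{im}$. For $J\subset I$ let $F^v(J)=\{v:\alpha_i(v)=0\ (i\in J),\ \alpha_i(v)>0\ (i\notin J)\}$; the vectorial facets are the sets $\pm wF^v(J)$, $w\in W^v$; such a facet is spherical if $\langle r_i: i\in J\rangle$ is finite. The Tits cone is $\mathcal T=\bigcup_{w,J}wF^v(J)$, with interior $\mathcal T^\circ$. The model apartment $\mathbb A$ is an affine space under $V$ with a set $\mathcal M$ of affine hyperplanes (walls), each of direction $\ker\alpha$ for some $\alpha\in\Phi$, infinitely many for each $\alpha\in\Phi$, and stable under the group $W$ generated by the reflections $r_M$, $M\in\mathcal M$ (with hyperplane $M$ and linear part $r_\alpha$ if $M$ has direction $\ker\alpha$). Imaginary walls are all hyperplanes of direction $\ker\alpha$, $\alpha\in\Delta_{im}$. On $\mathbb A$, $x\le y$ means $y-x\in\mathcal T$ and $x\mathrel{\overset{\circ}{\le}}y$ means $y-x\in\mathcal T^\circ\cup\{0\}$. Subsets are identified with principal filters; a filter $F$ is contained in a filter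 $F'$ if $F'\subset F$ as collections of sets (so $F$ is contained in a set $S$ iff $S\in F$); a map fixes a filter if it is the identity on one of its elements. For $\alpha\in\Delta$, let $D(\alpha)$ run through $\mathbb A$ and the closed half-spaces $\{\alpha\ge c\}$ bounded by a wall (real if $\alpha\in\Phi$, imaginary if $\alpha\in\Delta_{im}$). The enclosure $cl(F)$ of a filter $F$ is the filter of sets containing an element of $F$ of the form $\bigcap_{\alpha\in\Delta}D(\alpha)$. The facet $F(x,F^v)$, for $x\in\mathbb A$ and a vectorial facet $F^v$, is the filter of sets containing an intersection over $\alpha\in\Delta$ of such half-spaces, closed or open, which contains a neighbourhood of $x$ in $x+F^v$ (that is, which contains $germ_x(x+F^v)$). The chimney with base a facet $F$ and direction a vectorial facet $F^v$ is $\mathfrak r=cl(F+F^v)$; its germ is the filter of sets containing (an element of) some $cl(F+\xi+F^v)$, $\xi\in\overline{F^v}$. The chimney, or its germ, is flared if $F^v$ is spherical, full if no proper affine subspace contains $\mathfrak r$, and solid if the direction of the smallest affine subspace containing $\mathfrak r$ has finite pointwise stabilizer in $W^v$. For $x\ne y$ with $x\le y$ or $y\le x$, the germ at $x$ of $[x,y]\setminus\{x\}$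 is a preordered interval germ; if $x\mathrel{\overset{\circ}{\le}}y$ or $y\mathrel{\overset{\circ}{\le}}x$, the half-line from $x$ through $y$ is generic. An affine hovel (masure affine) of type $\mathbb A$ is a set $\mathcal I$ covered by a set of subsets called apartments, such that: (MA1) each apartment $A$ carries a nonempty set $\mathrm{Isom}(\mathbb A,A)$ of bijections $\mathbb A\to A$ forming one orbit $f_0\circ W$; isomorphisms $A\to A'$ are the bijections carrying $\mathrm{Isom}(\mathbb A,A)$ to $\mathrm{Isom}(\mathbb A,A')$, and all notions above are transported to $A$ (giving $\le_A$, $\overset{\circ}{\le}_A$, segments $[x,y]_A$, $cl_A$, facets, chimneys, …); (MA2) if $F$ is a point, a preordered interval germ, a generic half-line or a solid chimney of an apartment $A$, and an apartment $A'$ contains $F$, then $A\cap A'$ contains $cl_A(F)$ and some isomorphism $A\to A'$ fixes $cl_A(F)$; (MA3) if $\mathfrak R$ is a flared chimney germ and $F$ a facet or a solid chimney germ, some apartment contains $\mathfrak R$ and $F$; (MA4) if two apartments $A,A'$ contain $\mathfrak R$ and $F$ as in (MA3), then $A\cap A'$ contains $cl_A(\mathfrak R\cup F)$ and some isomorphism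 $A\to A'$ fixes it. **Statement.** Let $\mathcal I$ be an affine hovel, $A$ an apartment and $\mathfrak R$ the germ of a full flared chimney of $A$. There is exactly one map $\rho=\rho_{A,\mathfrak R}:\mathcal I\to A$, the retraction onto $A$ with centre $\mathfrak R$, such that for every $x\in\mathcal I$ there are an apartment $A_x$ containing $\mathfrak R$ and $x$ and an isomorphism $\varphi:A_x\to A$ fixing $\mathfrak R$, and $\rho(x)=\varphi(x)$ for every such $A_x$ and $\varphi$. Let $x,y$ be two points of an apartment $A'$. 1. If $x\le_{A'}y$, there is a subdivision $z_0=x,z_1,\dots,z_n=y$ of the segment $[x,y]_{A'}$ such that $\rho([z_{i-1},z_i]_{A'})=[\rho z_{i-1},\rho z_i]_A$ and $\rho z_{i-1}\le_A\rho z_i$ for $1\le i\le n$; thus $\rho([x,y]_{A'})$ is the broken line $[\rho z_0,\rho z_1]_A\cup\dots\cup[\rho z_{n-1},\rho z_n]_A$. Moreover $\rho x\le_A\rho y$. 2. The same holds with $\overset{\circ}{\le}$ in place of $\le$ throughout: if $x\mathrel{\overset{\circ}{\le}_{A'}}y$, there is such a subdivision with $\rho z_{i-1}\mathrel{\overset{\circ}{\le}_A}\rho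 z_i$ for all $i$, and $\rho x\mathrel{\overset{\circ}{\le}_A}\rho y$. -/

import Mathlib

open Set Filter Topology

noncomputable section

/-- Simple roots `α i ∈ V*` (linearly independent) and simple coroots `α i ∨ ∈ V`
with `α i (α i ∨) = 2`. -/
structure RootBasis (ι V : Type*) [NormedAddCommGroup V] [NormedSpace ℝ V] where
  root : ι → Module.Dual ℝ V
  coroot : ι → V
  root_coroot : ∀ i, root i (coroot i) = 2
  linearIndependent_root : LinearIndependent ℝ root

namespace RootBasis

variable {ι V : Type*} [NormedAddCommGroup V] [NormedSpace ℝ V] (B : RootBasis ι V)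

/-- The simple reflection `r_i (v) = v - α_i(v) α_i∨`. -/
def simpleRefl (i : ι) : V ≃ₗ[ℝ] V := Module.reflection (B.root_coroot i)

/-- The vectorial Weyl group `W^v`. -/
def vWeyl : Subgroup (V ≃ₗ[ℝ] V) := Subgroup.closure (range B.simpleRefl)

/-- The contragredient action on `V*`: `(w α)(v) = α (w⁻¹ v)`. -/
def dualAct (w : V ≃ₗ[ℝ] V) (α : Module.Dual ℝ V) : Module.Dual ℝ V :=
  α ∘ₗ (w⁻¹ : V ≃ₗ[ℝ] V).toLinearMap

/-- The set `Φ` of real roots. -/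
def realRoots : Set (Module.Dual ℝ V) :=
  {β | ∃ w ∈ B.vWeyl, ∃ i, β = dualAct w (B.root i)}

/-- The cone `⊕ ℝ⁺ α_i`. -/
def posCone [Fintype ι] : Set (Module.Dual ℝ V) :=
  {β | ∃ c : ι → ℝ, (∀ i, 0 ≤ c i) ∧ β = ∑ i, c i • B.root i}

/-- The set `Φ⁺` of positive real roots. -/
def posRoots [Fintype ι] : Set (Module.Dual ℝ V) := B.realRoots ∩ B.posCone

/-- The facet `F^v(J)` of the closed fundamental chamber. -/
def fundFacet (J : Set ι) : Set V :=
  {v | (∀ i ∈ J, B.root i v = 0) ∧ ∀ i ∉ J, 0 < B.root i v}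

/-- `J` is spherical: the group generated by the `r_i`, `i ∈ J`, is finite. -/
def IsSphericalType (J : Set ι) : Prop :=
  ((Subgroup.closure (B.simpleRefl '' J) : Subgroup (V ≃ₗ[ℝ] V)) : Set (V ≃ₗ[ℝ] V)).Finite

/-- `Fv` is a positive or negative vectorial facet `± w F^v(J)` of type `J`. -/
def IsFacetOfType (J : Set ι) (Fv : Set V) : Prop :=
  ∃ w ∈ B.vWeyl, Fv = w '' B.fundFacet J ∨ Fv = (fun v => -w v) '' B.fundFacet J

/-- Vectorial facets (of both signs). -/
def IsVFacet (Fv : Set V) : Prop := ∃ J, B.IsFacetOfType J Fv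

/-- Spherical vectorial facets (of both signs). -/
def IsSphericalVFacet (Fv : Set V) : Prop := ∃ J, B.IsSphericalType J ∧ B.IsFacetOfType J Fv

/-- The Tits cone. -/
def titsCone : Set V := ⋃ w ∈ B.vWeyl, ⋃ J : Set ι, w '' B.fundFacet J

end RootBasis

/-- The vectorial data underlying an apartment, with a moderately imaginary set of
imaginary roots. -/
structure ApartmentRootDatum (ι V : Type*) [Fintype ι] [NormedAddCommGroup V] [NormedSpace ℝ V]
    extends RootBasis ι V where
  /-- `W^v` is a Coxeter group with generators the `r_i`; its Coxeter matrix is given by the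
  orders of the `r_i r_j` (`0` stands for `∞`). -/
  coxeterMatrix : CoxeterMatrix ι
  coxeterSystem : CoxeterSystem coxeterMatrix toRootBasis.vWeyl
  simple_eq : ∀ i, (coxeterSystem.simple i : V ≃ₗ[ℝ] V) = toRootBasis.simpleRefl i
  coxeterMatrix_eq : ∀ i j, coxeterMatrix i j =
    orderOf (toRootBasis.simpleRefl i * toRootBasis.simpleRefl j)
  /-- The reflection `r_α = w r_i w⁻¹` only depends on the real root `α = w α_i`. -/
  refl_wellDefined : ∀ w ∈ toRootBasis.vWeyl, ∀ w' ∈ toRootBasis.vWeyl, ∀ i j,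
    RootBasis.dualAct w (root i) = RootBasis.dualAct w' (root j) →
      w * toRootBasis.simpleRefl i * w⁻¹ = w' * toRootBasis.simpleRefl j * w'⁻¹
  pos_or_neg : ∀ β ∈ toRootBasis.realRoots, β ∈ toRootBasis.posRoots ∨ -β ∈ toRootBasis.posRoots
  eq_one_of_stabilizes : ∀ w ∈ toRootBasis.vWeyl,
    RootBasis.dualAct w '' toRootBasis.posRoots = toRootBasis.posRoots → w = 1
  length_lt_iff : ∀ (w : toRootBasis.vWeyl) (i : ι),
    RootBasis.dualAct (w : V ≃ₗ[ℝ] V) (root i) ∈ toRootBasis.posRoots ↔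
      coxeterSystem.length w < coxeterSystem.length (w * coxeterSystem.simple i)
  reduced : ∀ β ∈ toRootBasis.realRoots, ∀ c : ℝ, 0 ≤ c → c • β ∈ toRootBasis.realRoots →
    c • β = β
  /-- The set `Δ_im` of imaginary roots. -/
  imagRoots : Set (Module.Dual ℝ V)
  imag_ne_zero : ∀ β ∈ imagRoots, β ≠ 0
  imag_ne_smul_real : ∀ β ∈ imagRoots, ∀ γ ∈ toRootBasis.realRoots, ∀ c : ℝ, β ≠ c • γ
  imag_act : ∀ w ∈ toRootBasis.vWeyl, ∀ β ∈ imagRoots, RootBasis.dualAct w β ∈ imagRoots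
  imag_neg : ∀ β ∈ imagRoots, -β ∈ imagRoots
  /-- Moderately imaginary case. -/
  imag_pos_or_neg : ∀ β ∈ imagRoots, β ∈ toRootBasis.posCone ∨ -β ∈ toRootBasis.posCone
  imag_pos_act : ∀ w ∈ toRootBasis.vWeyl, ∀ β ∈ imagRoots, β ∈ toRootBasis.posCone →
    RootBasis.dualAct w β ∈ toRootBasis.posCone

/-- The set `Δ = Φ ∪ Δ_im` of all roots. -/
def ApartmentRootDatum.allRoots {ι V : Type*} [Fintype ι] [NormedAddCommGroup V] [NormedSpace ℝ V]
    (D : ApartmentRootDatum ι V) : Set (Module.Dual ℝ V) := D.realRoots ∪ D.imagRoots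

section Walls

variable {ι V P : Type*} [NormedAddCommGroup V] [NormedSpace ℝ V]
  [MetricSpace P] [NormedAddTorsor V P]

/-- The affine hyperplane through `p` with direction `ker α`. -/
def wallThrough (α : Module.Dual ℝ V) (p : P) : AffineSubspace ℝ P :=
  AffineSubspace.mk' p (LinearMap.ker α)

/-- The closed half-space `α ≥ α(p)`. -/
def closedHalf (α : Module.Dual ℝ V) (p : P) : Set P := {x | 0 ≤ α (x -ᵥ p)}

/-- The open half-space `α > α(p)`. -/
def openHalf (α : Module.Dual ℝ V) (p : P) : Set P := {x | 0 < α (x -ᵥ p)}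

/-- The affine map fixing `p` with linear part `g`. -/
def affineAt (g : V ≃ₗ[ℝ] V) (p : P) : P ≃ᵃ[ℝ] P :=
  ((AffineEquiv.vaddConst ℝ p).symm.trans g.toAffineEquiv).trans (AffineEquiv.vaddConst ℝ p)

/-- The affine Weyl group `W`, generated by the reflections `r_M` in the walls `M`:
if `M` contains `p` and has direction `ker (w α_i)`, then `r_M` fixes `p` and has linear
part `w r_i w⁻¹`. -/
def affineWeyl (B : RootBasis ι V) (walls : Set (AffineSubspace ℝ P)) :
    Subgroup (P ≃ᵃ[ℝ] P) :=
  Subgroup.closure {g | ∃ w ∈ B.vWeyl, ∃ (i : ι) (p : P),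
    wallThrough (RootBasis.dualAct w (B.root i)) p ∈ walls ∧
      g = affineAt (w * B.simpleRefl i * w⁻¹) p}

end Walls

/-- The model affine apartment: an affine space `P` under `V` with a set of (real) walls. -/
structure ModelApartment {ι V : Type*} [Fintype ι] [NormedAddCommGroup V] [NormedSpace ℝ V]
    (D : ApartmentRootDatum ι V) (P : Type*) [MetricSpace P] [NormedAddTorsor V P] where
  walls : Set (AffineSubspace ℝ P)
  exists_root : ∀ M ∈ walls, (M : Set P).Nonempty ∧
    ∃ α ∈ D.realRoots, M.direction = LinearMap.ker α
  infinite_walls : ∀ α ∈ D.realRoots, {M ∈ walls | M.direction = LinearMap.ker α}.Infinite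
  walls_stable : ∀ g ∈ affineWeyl D.toRootBasis walls, ∀ M ∈ walls,
    M.map (g : P →ᵃ[ℝ] P) ∈ walls

namespace ModelApartment

variable {ι V : Type*} [Fintype ι] [NormedAddCommGroup V] [NormedSpace ℝ V]
  {D : ApartmentRootDatum ι V} {P : Type*} [MetricSpace P] [NormedAddTorsor V P]
  (𝔸 : ModelApartment D P)

/-- The affine Weyl group `W` of the model apartment. -/
def weyl : Subgroup (P ≃ᵃ[ℝ] P) := affineWeyl D.toRootBasis 𝔸.walls

/-- The hyperplane of direction `ker α` through `p` is a real or an imaginary wall: for a real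
root it has to belong to the given set of walls, for an imaginary root all of them are allowed. -/
def IsWallOf (α : Module.Dual ℝ V) (p : P) : Prop :=
  (α ∈ D.realRoots ∧ wallThrough α p ∈ 𝔸.walls) ∨ α ∈ D.imagRoots

/-- The sets `D(α, k)` for `k ∈ Γ_α ∪ {∞}`. -/
def closedHalves (α : Module.Dual ℝ V) : Set (Set P) :=
  {H | H = univ ∨ ∃ p, 𝔸.IsWallOf α p ∧ H = closedHalf α p}

/-- The sets `D(α, k)` and `D°(α, k)` for `k ∈ Γ_α ∪ {∞}`. -/
def halves (α : Module.Dual ℝ V) : Set (Set P) :=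
  {H | H = univ ∨ ∃ p, 𝔸.IsWallOf α p ∧ (H = closedHalf α p ∨ H = openHalf α p)}

theorem halves_total (α : Module.Dual ℝ V) (H : Set P) (h : H ∈ 𝔸.halves α) (H' : Set P)
    (h' : H' ∈ 𝔸.halves α) : H ⊆ H' ∨ H' ⊆ H := by
  rcases h with rfl | ⟨p, -, hp⟩
  · exact Or.inr (subset_univ _)
  rcases h' with rfl | ⟨q, -, hq⟩
  · exact Or.inl (subset_univ _)
  have key : ∀ x : P, α (x -ᵥ q) = α (x -ᵥ p) + α (p -ᵥ q) := fun x => by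
    rw [← map_add, vsub_add_vsub_cancel]
  rcases lt_trichotomy (α (p -ᵥ q)) 0 with h | h | h
  · right
    rcases hp with rfl | rfl <;> rcases hq with rfl | rfl <;> intro x hx <;>
      simp only [closedHalf, openHalf, mem_ofPred_eq] at hx ⊢ <;> linarith [key x]
  · rcases hp with rfl | rfl
    · right
      rcases hq with rfl | rfl <;> intro x hx <;>
        simp only [closedHalf, openHalf, mem_ofPred_eq] at hx ⊢ <;> linarith [key x]
    · left
      rcases hq with rfl | rfl <;> intro x hx <;>
        simp only [closedHalf, openHalf, mem_ofPred_eq] at hx ⊢ <;> linarith [key x]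
  · left
    rcases hp with rfl | rfl <;> rcases hq with rfl | rfl <;> intro x hx <;>
      simp only [closedHalf, openHalf, mem_ofPred_eq] at hx ⊢ <;> linarith [key x]

theorem closedHalves_subset (α : Module.Dual ℝ V) : 𝔸.closedHalves α ⊆ 𝔸.halves α := by
  rintro H (h | ⟨p, hp, h⟩)
  · exact Or.inl h
  · exact Or.inr ⟨p, hp, Or.inl h⟩

/-- For a family `𝓗 α` of sets of half-spaces, the filter of all sets which contain an element
of `F` of the form `⋂_{α ∈ Δ} H_α` with `H_α ∈ 𝓗 α`. -/
def hullFilter (𝓗 : Module.Dual ℝ V → Set (Set P)) (huniv : ∀ α, univ ∈ 𝓗 α)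
    (h𝓗 : ∀ α, ∀ H ∈ 𝓗 α, ∀ H' ∈ 𝓗 α, H ⊆ H' ∨ H' ⊆ H) (F : Filter P) : Filter P where
  sets := {S | ∃ H : Module.Dual ℝ V → Set P, (∀ α ∈ D.allRoots, H α ∈ 𝓗 α) ∧
    (⋂ α ∈ D.allRoots, H α) ∈ F ∧ (⋂ α ∈ D.allRoots, H α) ⊆ S}
  univ_sets := ⟨fun _ => univ, fun α _ => huniv α, by simp, subset_univ _⟩
  sets_of_superset := by
    rintro S T ⟨H, h1, h2, h3⟩ hST
    exact ⟨H, h1, h2, h3.trans hST⟩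
  inter_sets := by
    rintro S T ⟨H, h1, h2, h3⟩ ⟨K, k1, k2, k3⟩
    have e : (⋂ α ∈ D.allRoots, H α ∩ K α) =
        (⋂ α ∈ D.allRoots, H α) ∩ ⋂ α ∈ D.allRoots, K α := by
      ext x
      simp only [mem_iInter, mem_inter_iff]
      exact ⟨fun h => ⟨fun α hα => (h α hα).1, fun α hα => (h α hα).2⟩,
        fun h α hα => ⟨h.1 α hα, h.2 α hα⟩⟩
    refine ⟨fun α => H α ∩ K α, fun α hα => ?_, ?_, ?_⟩
    · rcases h𝓗 α _ (h1 α hα) _ (k1 α hα) with h | h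
      · simpa only [inter_eq_left.2 h] using h1 α hα
      · simpa only [inter_eq_right.2 h] using k1 α hα
    · simpa only [e] using inter_mem h2 k2
    · simpa only [e] using inter_subset_inter h3 k3

/-- The enclosure `cl(F)`: the filter of all sets which contain an element of `F` of the form
`⋂_{α ∈ Δ} D(α, k_α)`. Subsets are identified with principal filters, so that inclusion of
filters is `≤`, and a filter `F` is contained in a set `S` when `S ∈ F`. -/
def cl (F : Filter P) : Filter P :=
  hullFilter (D := D) 𝔸.closedHalves (fun _ => Or.inl rfl)
    (fun α H h H' h' => 𝔸.halves_total α H (𝔸.closedHalves_subset α h) H'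
      (𝔸.closedHalves_subset α h')) F

/-- The local facet `germ_x (x + F^v)`. -/
def localFacet (x : P) (Fv : Set V) : Filter P := 𝓝[(fun v => v +ᵥ x) '' Fv] x

/-- The facet `F(x, F^v)`: the filter of all sets which contain an intersection of half-spaces
`D(α, k_α)` or `D°(α, k_α)` that contains the local facet. -/
def facet (x : P) (Fv : Set V) : Filter P :=
  hullFilter (D := D) 𝔸.halves (fun _ => Or.inl rfl) 𝔸.halves_total (localFacet x Fv)

/-- `cl(F + ξ + F^v)` for the facet `F = F(x, F₀^v)`. -/
def shiftedChimney (x : P) (F₀ Fv : Set V) (ξ : V) : Filter P :=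
  𝔸.cl (Filter.map₂ (fun p v => v +ᵥ (ξ +ᵥ p)) (𝔸.facet x F₀) (𝓟 Fv))

/-- The chimney `𝔯(F, F^v) = cl(F + F^v)` with base `F = F(x, F₀^v)` and direction `F^v`. -/
def chimney (x : P) (F₀ Fv : Set V) : Filter P :=
  𝔸.cl (Filter.map₂ (fun p v => v +ᵥ p) (𝔸.facet x F₀) (𝓟 Fv))

/-- The germ of a chimney: the filter of sets containing one of the shortenings
`cl(F + ξ + F^v)`, `ξ ∈ closure F^v` (a directed family). -/
def chimneyGerm (x : P) (F₀ Fv : Set V) : Filter P :=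
  ⨅ ξ ∈ closure Fv, 𝔸.shiftedChimney x F₀ Fv ξ

/-- The support of a filter: the smallest affine subspace containing it. -/
def support (F : Filter P) : AffineSubspace ℝ P :=
  sInf {E : AffineSubspace ℝ P | (E : Set P) ∈ F}

/-- The chimney is solid: the direction of its support has a finite fixer in `W^v`. -/
def IsSolid (r : Filter P) : Prop :=
  {w : V ≃ₗ[ℝ] V | w ∈ D.vWeyl ∧ ∀ u ∈ (support r).direction, w u = u}.Finite

/-- The chimney is full: its support is the whole apartment. -/
def IsFull (r : Filter P) : Prop := support r = ⊤

/-- The open interval germ `]x, y) = germ_x (]x, y])`. -/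
def intervalGerm (x y : P) : Filter P := 𝓝[AffineMap.lineMap x y '' Ioc (0 : ℝ) 1] x

/-- `x ≤ y` in the model apartment. -/
def Le (_𝔸 : ModelApartment D P) (x y : P) : Prop := y -ᵥ x ∈ D.titsCone

/-- `x ≤° y` in the model apartment. -/
def OpenLe (_𝔸 : ModelApartment D P) (x y : P) : Prop :=
  y -ᵥ x ∈ interior D.titsCone ∪ {0}

def IsPoint (G : Filter P) : Prop := ∃ x : P, G = 𝓟 {x}

/-- Germs of preordered intervals. -/
def IsPreorderedIntervalGerm (G : Filter P) : Prop :=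
  ∃ x y : P, x ≠ y ∧ (𝔸.Le x y ∨ 𝔸.Le y x) ∧ G = intervalGerm x y

/-- Generic half-lines (as principal filters). -/
def IsGenericRay (G : Filter P) : Prop :=
  ∃ x y : P, x ≠ y ∧ (𝔸.OpenLe x y ∨ 𝔸.OpenLe y x) ∧
    G = 𝓟 (AffineMap.lineMap x y '' Ici (0 : ℝ))

def IsFacet (G : Filter P) : Prop := ∃ (x : P) (Fv : Set V), D.IsVFacet Fv ∧ G = 𝔸.facet x Fv

def IsSolidChimney (G : Filter P) : Prop :=
  ∃ (x : P) (F₀ Fv : Set V), D.IsVFacet F₀ ∧ D.IsVFacet Fv ∧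
    IsSolid (D := D) (𝔸.chimney x F₀ Fv) ∧ G = 𝔸.chimney x F₀ Fv

def IsSolidChimneyGerm (G : Filter P) : Prop :=
  ∃ (x : P) (F₀ Fv : Set V), D.IsVFacet F₀ ∧ D.IsVFacet Fv ∧
    IsSolid (D := D) (𝔸.chimney x F₀ Fv) ∧ G = 𝔸.chimneyGerm x F₀ Fv

/-- Germs of flared chimneys: the direction is spherical. -/
def IsFlaredChimneyGerm (G : Filter P) : Prop :=
  ∃ (x : P) (F₀ Fv : Set V), D.IsVFacet F₀ ∧ D.IsSphericalVFacet Fv ∧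
    G = 𝔸.chimneyGerm x F₀ Fv

/-- Germs of full flared chimneys. -/
def IsFullFlaredChimneyGerm (G : Filter P) : Prop :=
  ∃ (x : P) (F₀ Fv : Set V), D.IsVFacet F₀ ∧ D.IsSphericalVFacet Fv ∧
    IsFull (𝔸.chimney x F₀ Fv) ∧ G = 𝔸.chimneyGerm x F₀ Fv

end ModelApartment

/-- A set covered by subsets (apartments), each with a structure of apartment of type `𝔸`,
that is a nonempty set `isom A` of bijections `𝔸 → A` which is a single orbit under `W`. -/
structure ApartmentSystem {ι V : Type*} [Fintype ι] [NormedAddCommGroup V] [NormedSpace ℝ V]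
    {D : ApartmentRootDatum ι V} {P : Type*} [MetricSpace P] [NormedAddTorsor V P]
    (𝔸 : ModelApartment D P) (X : Type*) where
  apartments : Set (Set X)
  sUnion_apartments : ⋃₀ apartments = univ
  isom : (A : Set X) → Set (P ≃ A)
  isom_nonempty : ∀ A ∈ apartments, (isom A).Nonempty
  isom_iff : ∀ A ∈ apartments, ∀ f₀ ∈ isom A, ∀ f : P ≃ A,
    f ∈ isom A ↔ ∃ w ∈ 𝔸.weyl, ∀ p, f p = f₀ (w p)

namespace ApartmentSystem

variable {ι V : Type*} [Fintype ι] [NormedAddCommGroup V] [NormedSpace ℝ V]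
  {D : ApartmentRootDatum ι V} {P : Type*} [MetricSpace P] [NormedAddTorsor V P]
  {𝔸 : ModelApartment D P} {X : Type*} (S : ApartmentSystem 𝔸 X)

/-- The transport to `X` of a filter on the model apartment. -/
def push {A : Set X} (f : P ≃ A) (G : Filter P) : Filter X := G.map (fun p => (f p : X))

/-- The filter `F` on `X` is, in the apartment `A`, an object of the kind `K`. -/
def IsKindIn (K : Filter P → Prop) (A : Set X) (F : Filter X) : Prop :=
  ∃ f ∈ S.isom A, ∃ G, K G ∧ F = push f G

/-- The filter `F` on `X` is, in some apartment, an object of the kind `K`. -/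
def IsKind (K : Filter P → Prop) (F : Filter X) : Prop :=
  ∃ A ∈ S.apartments, S.IsKindIn K A F

/-- Isomorphisms of apartments. -/
def IsIso {A A' : Set X} (φ : A ≃ A') : Prop := ∃ f ∈ S.isom A, f.trans φ ∈ S.isom A'

/-- `φ` fixes (pointwise) the filter `F`: it is the identity on some element of `F`. -/
def Fixes {A A' : Set X} (φ : A ≃ A') (F : Filter X) : Prop :=
  ∃ T ∈ F, ∀ a : A, (a : X) ∈ T → (φ a : X) = a

/-- The conclusion common to the axioms (MA2) and (MA4) for a filter `F` contained in `A`: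
`A ∩ A'` contains the enclosure `cl_A(F)` of `F` in `A` and there is an isomorphism of `A`
onto `A'` fixing this enclosure. -/
def EnclosureShared (A A' : Set X) (F : Filter X) : Prop :=
  ∀ f ∈ S.isom A,
    A ∩ A' ∈ push f (𝔸.cl (F.comap fun p => (f p : X))) ∧
      ∃ φ : A ≃ A', S.IsIso φ ∧ Fixes φ (push f (𝔸.cl (F.comap fun p => (f p : X))))

/-- The relation `≤_A` on the apartment `A`. -/
def Le (A : Set X) (x y : X) : Prop :=
  ∃ f ∈ S.isom A, ∃ p q : P, (f p : X) = x ∧ (f q : X) = y ∧ 𝔸.Le p q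

/-- The relation `≤°_A` on the apartment `A`. -/
def OpenLe (A : Set X) (x y : X) : Prop :=
  ∃ f ∈ S.isom A, ∃ p q : P, (f p : X) = x ∧ (f q : X) = y ∧ 𝔸.OpenLe p q

/-- The segment `[x, y]_A` in the apartment `A`. -/
def seg (A : Set X) (x y : X) : Set X :=
  {z | ∃ f ∈ S.isom A, ∃ p q r : P, (f p : X) = x ∧ (f q : X) = y ∧
    r ∈ affineSegment ℝ p q ∧ (f r : X) = z}

/-- `z₀ = x, z₁, …, z_n = y` is a subdivision of the segment `[x, y]_A`. -/
def IsSubdivision (A : Set X) (x y : X) {n : ℕ} (z : Fin (n + 1) → X) : Prop :=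
  ∃ f ∈ S.isom A, ∃ p q : P, (f p : X) = x ∧ (f q : X) = y ∧
    ∃ t : Fin (n + 1) → ℝ, Monotone t ∧ t 0 = 0 ∧ t (Fin.last n) = 1 ∧
      ∀ i, z i = f (AffineMap.lineMap p q (t i))

/-- `ρ` is the retraction of `X` onto `A` with centre `R`: for every `x` there is an apartment
`A'` containing `x` and `R` together with an isomorphism `φ : A' → A` fixing `R`, and
`ρ x = φ x` for all such `A'` and `φ`. -/
def IsRetraction (A : Set X) (R : Filter X) (ρ : X → A) : Prop :=
  ∀ x : X,
    (∃ A' ∈ S.apartments, A' ∈ R ∧ x ∈ A' ∧ ∃ φ : A' ≃ A, S.IsIso φ ∧ Fixes φ R) ∧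
    ∀ A' ∈ S.apartments, A' ∈ R → ∀ hx : x ∈ A', ∀ φ : A' ≃ A, S.IsIso φ → Fixes φ R →
      ρ x = φ ⟨x, hx⟩

/-- The image under `ρ` of the segment `[x, y]_{A'}` is a broken line in `A`, obtained from a
subdivision `z₀, …, z_n` of the segment, whose successive vertices `ρ z_i` increase for the
relation `rel`. -/
def MapsToIncreasingBrokenLine (A A' : Set X) (ρ : X → A) (rel : X → X → Prop) (x y : X) :
    Prop :=
  ∃ (n : ℕ) (z : Fin (n + 1) → X), S.IsSubdivision A' x y z ∧
    (fun u => (ρ u : X)) '' S.seg A' x y =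
      ⋃ i : Fin n, S.seg A (ρ (z i.castSucc)) (ρ (z i.succ)) ∧
    ∀ i : Fin n,
      (fun u => (ρ u : X)) '' S.seg A' (z i.castSucc) (z i.succ) =
        S.seg A (ρ (z i.castSucc)) (ρ (z i.succ)) ∧
      rel (ρ (z i.castSucc)) (ρ (z i.succ))

end ApartmentSystem

/-- Affine hovels (masures affines) of type `𝔸`. -/
structure AffineHovel {ι V : Type*} [Fintype ι] [NormedAddCommGroup V] [NormedSpace ℝ V]
    {D : ApartmentRootDatum ι V} {P : Type*} [MetricSpace P] [NormedAddTorsor V P]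
    (𝔸 : ModelApartment D P) (X : Type*) extends ApartmentSystem 𝔸 X where
  /-- (MA2) -/
  ma2 : ∀ A ∈ apartments, ∀ F : Filter X,
    toApartmentSystem.IsKindIn ModelApartment.IsPoint A F ∨
      toApartmentSystem.IsKindIn 𝔸.IsPreorderedIntervalGerm A F ∨
      toApartmentSystem.IsKindIn 𝔸.IsGenericRay A F ∨
      toApartmentSystem.IsKindIn 𝔸.IsSolidChimney A F →
    ∀ A' ∈ apartments, A' ∈ F → toApartmentSystem.EnclosureShared A A' F
  /-- (MA3) -/
  ma3 : ∀ R F : Filter X, toApartmentSystem.IsKind 𝔸.IsFlaredChimneyGerm R →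
    toApartmentSystem.IsKind 𝔸.IsFacet F ∨
      toApartmentSystem.IsKind 𝔸.IsSolidChimneyGerm F →
    ∃ A ∈ apartments, A ∈ R ∧ A ∈ F
  /-- (MA4) -/
  ma4 : ∀ R F : Filter X, toApartmentSystem.IsKind 𝔸.IsFlaredChimneyGerm R →
    toApartmentSystem.IsKind 𝔸.IsFacet F ∨
      toApartmentSystem.IsKind 𝔸.IsSolidChimneyGerm F →
    ∀ A ∈ apartments, A ∈ R → A ∈ F → ∀ A' ∈ apartments, A' ∈ R → A' ∈ F →
      toApartmentSystem.EnclosureShared A A' (R ⊔ F)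

end

/-! An element of `W` fixing an element of the germ of a full flared chimney is trivial: if an
affine subspace contains the germ, its direction contains some `η ∈ F^v`, and since `F^v` is
spherical every root positive at `η` becomes nonnegative at `u + t • η` for large `t`; hence the
subspace contains the chimney, which is full. Uniqueness of `ρ` follows with (MA4).

On either side of each point of a preordered segment, an apartment containing `R` and the facet
which contains the interval germ also contains a piece of the segment by (MA2), so `ρ` is locally
the restriction of an isomorphism of apartments. Connectedness of the segment yields the
subdivision. Isomorphisms respect every `W^v`-stable cone, and the Tits cone is convex, being the
set of vectors at which only finitely many positive roots are negative; adding up the pieces gives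
`ρ x ≤ ρ y`. -/

theorem reflTransGen_of_eventually {T : Type*} [ConditionallyCompleteLinearOrder T]
    [DenselyOrdered T] [TopologicalSpace T] [OrderTopology T] {r : T → T → Prop}
    (hr : ∀ ⦃s u t⦄, s ≤ u → u ≤ t → r s t → r s u) (hright : ∀ t, ∀ᶠ u in 𝓝[≥] t, r t u)
    (hleft : ∀ t, ∀ᶠ u in 𝓝[≤] t, r u t) {a b : T} (hab : a ≤ b) :
    Relation.ReflTransGen (fun s t => s ≤ t ∧ r s t) a b := by
  set C : T → Prop := Relation.ReflTransGen (fun s t => s ≤ t ∧ r s t) a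
  have truncate : ∀ {t}, C t → ∀ {u}, a ≤ u → u ≤ t → C u := by
    intro t ht
    induction ht with
    | refl => exact fun hau hua => hau.antisymm hua ▸ .refl
    | @tail s t hs hst ih =>
      intro u hau hut
      rcases le_total u s with hus | hsu
      · exact ih hau hus
      · exact hs.tail ⟨hsu, hr hsu hut hst.2⟩
  refine (isPreconnected_Ici.induction₂ (fun s t => C s ↔ C t) (fun t ht => ?_)
    (fun _ _ _ _ _ _ => Iff.trans) (fun _ _ _ _ => Iff.symm) self_mem_Ici hab).1 .refl
  filter_upwards [self_mem_nhdsWithin,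
    nhdsWithin_le_nhds (eventually_nhdsWithin_iff.1 (hright t)),
    nhdsWithin_le_nhds (eventually_nhdsWithin_iff.1 (hleft t))] with u hu hur hul
  rcases le_total t u with htu | hut
  · exact ⟨fun h => h.tail ⟨htu, hur htu⟩, fun h => truncate h ht htu⟩
  · exact ⟨fun h => truncate h hu hut, fun h => h.tail ⟨hut, hul hut⟩⟩

theorem exists_fin_of_reflTransGen {T : Type*} {r : T → T → Prop} {a b : T}
    (h : Relation.ReflTransGen r a b) :
    ∃ (n : ℕ) (τ : Fin (n + 1) → T), τ 0 = a ∧ τ (Fin.last n) = b ∧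
      ∀ i : Fin n, r (τ i.castSucc) (τ i.succ) := by
  induction h with
  | refl => exact ⟨0, fun _ => a, rfl, rfl, fun i => i.elim0⟩
  | @tail b c _ hbc ih =>
    obtain ⟨n, τ, h0, hlast, hτ⟩ := ih
    refine ⟨n + 1, Fin.snoc τ c, ?_, Fin.snoc_last .., Fin.lastCases ?_ fun i => ?_⟩
    · exact (Fin.snoc_castSucc (α := fun _ => T) c τ 0).trans h0
    · rwa [Fin.snoc_castSucc, Fin.succ_last, Fin.snoc_last, hlast]
    · rw [Fin.snoc_castSucc, Fin.succ_castSucc, Fin.snoc_castSucc]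
      exact hτ i

theorem iUnion_Icc_castSucc_succ {T : Type*} [LinearOrder T] {n : ℕ} {τ : Fin (n + 2) → T}
    (hτ : Monotone τ) :
    ⋃ i : Fin (n + 1), Icc (τ i.castSucc) (τ i.succ) = Icc (τ 0) (τ (Fin.last (n + 1))) := by
  induction n with
  | zero => exact iSup_unique (ι := Fin 1) fun i => Icc (τ i.castSucc) (τ i.succ)
  | succ n ih =>
    have h := ih (τ := τ ∘ Fin.castSucc) (hτ.comp Fin.strictMono_castSucc.monotone)
    calc ⋃ i : Fin (n + 2), Icc (τ i.castSucc) (τ i.succ)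
      _ = (⋃ i : Fin (n + 1), Icc (τ i.castSucc.castSucc) (τ i.succ.castSucc)) ∪
          Icc (τ (Fin.last (n + 1)).castSucc) (τ (Fin.last (n + 2))) := by
        ext x
        simp only [mem_iUnion, mem_union, Fin.exists_fin_succ', Fin.succ_castSucc, Fin.succ_last]
      _ = Icc (τ 0) (τ (Fin.last (n + 2))) := by
        exact (congrArg (· ∪ _) h).trans
          (Icc_union_Icc_eq_Icc (hτ (Fin.zero_le _)) (hτ (Fin.le_last _)))

theorem affineSegment_lineMap {V P : Type*} [AddCommGroup V] [Module ℝ V] [AddTorsor V P]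
    (p q : P) {s t : ℝ} (hst : s ≤ t) :
    affineSegment ℝ (AffineMap.lineMap p q s) (AffineMap.lineMap p q t) =
      AffineMap.lineMap p q '' Icc s t := by
  rw [← affineSegment_image, affineSegment_eq_segment, segment_eq_Icc hst]

theorem lineMap_vsub_lineMap_mem {V P : Type*} [AddCommGroup V] [Module ℝ V] [AddTorsor V P]
    {C : PointedCone ℝ V} {p q : P} (hpq : q -ᵥ p ∈ C) {s t : ℝ} (hst : s ≤ t) :
    AffineMap.lineMap p q t -ᵥ AffineMap.lineMap p q s ∈ C := by
  rw [AffineMap.lineMap_apply, AffineMap.lineMap_apply, vadd_vsub_vadd_cancel_right, ← sub_smul]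
  exact C.smul_mem (sub_nonneg.2 hst) hpq

theorem exists_forall_dual_apply_eq {ι K V : Type*} [Finite ι] [Field K] [AddCommGroup V]
    [Module K V] {f : ι → Module.Dual K V} (hf : LinearIndependent K f) (c : ι → K) :
    ∃ v, ∀ i, f i v = c i := by
  have hspan : Submodule.span K (range (flip fun i => (f i : V → K))) = ⊤ :=
    span_flip_eq_top_iff_linearIndependent.2
      (hf.map' (LinearMap.ltoFun K V K K) (LinearMap.ker_eq_bot.2 DFunLike.coe_injective))
  have hrange : range (flip fun i => (f i : V → K)) = LinearMap.range (LinearMap.pi f) := rfl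
  rw [hrange, Submodule.span_eq, LinearMap.range_eq_top] at hspan
  exact (hspan c).imp fun v => congrFun

section InteriorPointedCone

open scoped Pointwise

variable {E : Type*} [AddCommGroup E] [Module ℝ E] [TopologicalSpace E]
  [IsTopologicalAddGroup E] [ContinuousConstSMul ℝ E]

/-- The interior of a convex cone, completed by the origin so that it is again pointed. -/
def interiorPointedCone (C : PointedCone ℝ E) : PointedCone ℝ E where
  carrier := interior C ∪ {0}
  zero_mem' := Or.inr rfl
  add_mem' := by
    rintro u v (hu | rfl) hv
    · have hv' : v ∈ C := hv.elim (interior_subset ·) (· ▸ C.zero_mem)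
      refine Or.inl (interior_mono ?_ (subset_interior_add_left (add_mem_add hu hv')))
      exact add_subset_iff.2 fun _ hx _ hy => C.add_mem hx hy
    · rwa [zero_add]
  smul_mem' := by
    rintro ⟨c, hc⟩ u (hu | rfl)
    · rcases hc.eq_or_lt with rfl | hc
      · exact Or.inr (zero_smul ℝ u)
      · have hcu : c • u ∈ interior (c • (C : Set E)) := by
          rw [interior_smul₀ hc.ne']
          exact smul_mem_smul_set hu
        exact Or.inl (interior_mono (smul_set_subset_iff.2 fun _ hx => C.smul_mem hc.le hx) hcu)
    · exact Or.inr (smul_zero _)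

theorem interiorPointedCone_le (C : PointedCone ℝ E) : interiorPointedCone C ≤ C :=
  fun _ hv => hv.elim (interior_subset ·) (· ▸ C.zero_mem)

theorem map_mem_interiorPointedCone {C : PointedCone ℝ E} {g : E ≃L[ℝ] E}
    (hg : ∀ v ∈ C, g v ∈ C) {v : E} (hv : v ∈ interiorPointedCone C) :
    g v ∈ interiorPointedCone C := by
  rcases hv with hv | rfl
  · have hgv : g v ∈ interior (g '' C) :=
      g.toHomeomorph.image_interior C ▸ mem_image_of_mem g hv
    exact Or.inl (interior_mono (image_subset_iff.2 hg) hgv)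
  · exact Or.inr (map_zero g)

end InteriorPointedCone

theorem eventually_map₂_principal {T U E : Type*} {f : T → U → E} {F : Filter T} {s : Set U}
    {Q : E → Prop} :
    (∀ᶠ x in Filter.map₂ f F (𝓟 s), Q x) ↔ ∀ᶠ a in F, ∀ b ∈ s, Q (f a b) := by
  constructor
  · intro h
    obtain ⟨t, ht, s', hs', hts⟩ := mem_map₂_iff.1 h
    filter_upwards [ht] with a ha b hb using hts (mem_image2_of_mem ha (hs' hb))
  · intro h
    exact mem_of_superset (image2_mem_map₂ h (mem_principal_self s))
      (image2_subset_iff.2 fun a ha => ha)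

namespace RootBasis

section Linear

variable {ι V : Type*} [NormedAddCommGroup V] [NormedSpace ℝ V] (B : RootBasis ι V)

theorem dualAct_apply_apply (w : V ≃ₗ[ℝ] V) (α : Module.Dual ℝ V) (v : V) :
    dualAct w α (w v) = α v :=
  congrArg α (w.symm_apply_apply v)

theorem dualAct_mul (w w' : V ≃ₗ[ℝ] V) (α : Module.Dual ℝ V) :
    dualAct (w * w') α = dualAct w (dualAct w' α) := rfl

theorem dualAct_one (α : Module.Dual ℝ V) : dualAct (1 : V ≃ₗ[ℝ] V) α = α := rfl

theorem dualAct_neg (w : V ≃ₗ[ℝ] V) (α : Module.Dual ℝ V) :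
    dualAct w (-α) = -dualAct w α := rfl

theorem dualAct_injective (w : V ≃ₗ[ℝ] V) : Function.Injective (dualAct w) := fun α β h => by
  simpa only [← dualAct_mul, inv_mul_cancel, dualAct_one] using congrArg (dualAct w⁻¹) h

theorem simpleRefl_apply (i : ι) (v : V) :
    B.simpleRefl i v = v - B.root i v • B.coroot i := rfl

theorem dualAct_simpleRefl_apply (i : ι) (α : Module.Dual ℝ V) (v : V) :
    dualAct (B.simpleRefl i) α v = α (B.simpleRefl i v) := rfl

theorem dualAct_simpleRefl_involutive (i : ι) :
    Function.Involutive (dualAct (B.simpleRefl i)) := fun α =>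
  LinearMap.ext fun v => congrArg α (Module.involutive_reflection (B.root_coroot i) v)

theorem root_simpleRefl (i : ι) (v : V) : B.root i (B.simpleRefl i v) = -B.root i v := by
  rw [simpleRefl_apply, map_sub, map_smul, root_coroot, smul_eq_mul]
  ring

theorem dualAct_simpleRefl_root (i : ι) : dualAct (B.simpleRefl i) (B.root i) = -B.root i :=
  LinearMap.ext (B.root_simpleRefl i)

theorem simpleRefl_mem_vWeyl (i : ι) : B.simpleRefl i ∈ B.vWeyl :=
  Subgroup.subset_closure (mem_range_self i)

theorem root_mem_realRoots (i : ι) : B.root i ∈ B.realRoots :=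
  ⟨1, one_mem _, i, rfl⟩

theorem dualAct_mem_realRoots {w : V ≃ₗ[ℝ] V} (hw : w ∈ B.vWeyl) {β : Module.Dual ℝ V}
    (hβ : β ∈ B.realRoots) : dualAct w β ∈ B.realRoots := by
  obtain ⟨w', hw', i, rfl⟩ := hβ
  exact ⟨w * w', mul_mem hw hw', i, rfl⟩

theorem neg_mem_realRoots {β : Module.Dual ℝ V} (hβ : β ∈ B.realRoots) : -β ∈ B.realRoots := by
  obtain ⟨w, hw, i, rfl⟩ := hβ
  refine ⟨w * B.simpleRefl i, mul_mem hw (B.simpleRefl_mem_vWeyl i), i, ?_⟩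
  rw [dualAct_mul, dualAct_simpleRefl_root, dualAct_neg]

/-- The closed fundamental chamber, where all simple roots are nonnegative. -/
def IsDominant (v : V) : Prop := ∀ i, 0 ≤ B.root i v

variable {B} in
theorem isDominant_of_mem_fundFacet {J : Set ι} {v : V} (hv : v ∈ B.fundFacet J) :
    B.IsDominant v := fun i => by
  by_cases hi : i ∈ J
  exacts [(hv.1 i hi).ge, (hv.2 i hi).le]

theorem mem_titsCone_iff_exists_isDominant {v : V} :
    v ∈ B.titsCone ↔ ∃ w ∈ B.vWeyl, B.IsDominant (w v) := by
  simp only [titsCone, mem_iUnion]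
  constructor
  · rintro ⟨w, hw, J, u, hu, rfl⟩
    exact ⟨w⁻¹, inv_mem hw,
      (w.symm_apply_apply u : w⁻¹ (w u) = u).symm ▸ isDominant_of_mem_fundFacet hu⟩
  · rintro ⟨w, hw, hv⟩
    exact ⟨w⁻¹, inv_mem hw, {i | B.root i (w v) = 0}, w v,
      ⟨fun i hi => hi, fun i hi => (hv i).lt_of_ne' hi⟩, w.symm_apply_apply v⟩

theorem map_mem_titsCone {w : V ≃ₗ[ℝ] V} (hw : w ∈ B.vWeyl) {v : V} (hv : v ∈ B.titsCone) :
    w v ∈ B.titsCone := by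
  obtain ⟨w', hw', hv⟩ := B.mem_titsCone_iff_exists_isDominant.1 hv
  refine B.mem_titsCone_iff_exists_isDominant.2 ⟨w' * w⁻¹, mul_mem hw' (inv_mem hw), ?_⟩
  rwa [← LinearEquiv.mul_apply, inv_mul_cancel_right]

theorem smul_mem_fundFacet {J : Set ι} {v : V} (hv : v ∈ B.fundFacet J) {t : ℝ} (ht : 0 < t) :
    t • v ∈ B.fundFacet J := by
  refine ⟨fun i hi => ?_, fun i hi => ?_⟩ <;> rw [map_smul, smul_eq_mul]
  · rw [hv.1 i hi, mul_zero]
  · exact mul_pos ht (hv.2 i hi)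

theorem fundFacet_nonempty [Finite ι] (J : Set ι) : (B.fundFacet J).Nonempty := by
  classical
  obtain ⟨v, hv⟩ := exists_forall_dual_apply_eq B.linearIndependent_root (Jᶜ.indicator 1)
  refine ⟨v, fun i hi => ?_, fun i hi => ?_⟩ <;> simp [hv, hi]

/-- The standard parabolic subgroup `W^v(J)`. -/
def parabolic (J : Set ι) : Subgroup (V ≃ₗ[ℝ] V) := Subgroup.closure (B.simpleRefl '' J)

theorem parabolic_le_vWeyl (J : Set ι) : B.parabolic J ≤ B.vWeyl :=
  Subgroup.closure_mono (image_subset_range _ _)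

theorem parabolic_univ : B.parabolic univ = B.vWeyl := by
  rw [parabolic, image_univ, vWeyl]

theorem simpleRefl_mem_parabolic {J : Set ι} {i : ι} (hi : i ∈ J) :
    B.simpleRefl i ∈ B.parabolic J :=
  Subgroup.subset_closure (mem_image_of_mem _ hi)

theorem apply_eq_self_of_mem_parabolic {J : Set ι} {w : V ≃ₗ[ℝ] V} (hw : w ∈ B.parabolic J)
    {v : V} (hv : ∀ i ∈ J, B.root i v = 0) : w v = v := by
  suffices B.parabolic J ≤ MulAction.stabilizer (V ≃ₗ[ℝ] V) v from this hw
  refine (Subgroup.closure_le _).2 (image_subset_iff.2 fun i hi => ?_)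
  change B.simpleRefl i v = v
  rw [simpleRefl_apply, hv i hi, zero_smul, sub_zero]

/-- The root system of `W^v(J)`: the roots `w α_i` with `w ∈ W^v(J)` and `i ∈ J`. -/
def parabolicRoots (J : Set ι) : Set (Module.Dual ℝ V) :=
  {β | ∃ w ∈ B.parabolic J, ∃ i ∈ J, β = dualAct w (B.root i)}

theorem parabolicRoots_subset_realRoots (J : Set ι) : B.parabolicRoots J ⊆ B.realRoots :=
  fun _ ⟨w, hw, i, _, h⟩ => ⟨w, B.parabolic_le_vWeyl J hw, i, h⟩

theorem root_mem_parabolicRoots {J : Set ι} {i : ι} (hi : i ∈ J) :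
    B.root i ∈ B.parabolicRoots J :=
  ⟨1, one_mem _, i, hi, rfl⟩

theorem dualAct_mem_parabolicRoots {J : Set ι} {w : V ≃ₗ[ℝ] V} (hw : w ∈ B.parabolic J)
    {β : Module.Dual ℝ V} (hβ : β ∈ B.parabolicRoots J) : dualAct w β ∈ B.parabolicRoots J := by
  obtain ⟨w', hw', i, hi, rfl⟩ := hβ
  exact ⟨w * w', mul_mem hw hw', i, hi, rfl⟩

variable {B} in
theorem IsSphericalType.finite_parabolicRoots [Finite ι] {J : Set ι} (hJ : B.IsSphericalType J) :
    (B.parabolicRoots J).Finite := by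
  refine ((Set.Finite.prod hJ (toFinite J)).image fun x => dualAct x.1 (B.root x.2)).subset ?_
  rintro _ ⟨w, hw, i, hi, rfl⟩
  exact ⟨(w, i), ⟨hw, hi⟩, rfl⟩

end Linear

section PositiveCone

variable {ι V : Type*} [Fintype ι] [NormedAddCommGroup V] [NormedSpace ℝ V]
  (B : RootBasis ι V)

theorem root_mem_posCone (i : ι) : B.root i ∈ B.posCone := by
  classical
  exact ⟨Pi.single i 1, Pi.single_nonneg (α := fun _ => ℝ) |>.2 zero_le_one,
    by simp [Pi.single_apply]⟩

variable {B}

theorem IsDominant.apply_nonneg {v : V} (hv : B.IsDominant v) {β : Module.Dual ℝ V}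
    (hβ : β ∈ B.posCone) : 0 ≤ β v := by
  obtain ⟨c, hc, rfl⟩ := hβ
  simp only [LinearMap.sum_apply, LinearMap.smul_apply, smul_eq_mul]
  exact Finset.sum_nonneg fun i _ => mul_nonneg (hc i) (hv i)

theorem neg_root_notMem_posCone (i : ι) : -B.root i ∉ B.posCone := by
  intro h
  obtain ⟨v, hv⟩ := exists_forall_dual_apply_eq B.linearIndependent_root 1
  have hdom : B.IsDominant v := fun j => (hv j).symm ▸ zero_le_one
  have := hdom.apply_nonneg h
  rw [LinearMap.neg_apply, hv, Pi.one_apply] at this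
  linarith

theorem eq_zero_or_pos_on_fundFacet {β : Module.Dual ℝ V} (hβ : β ∈ B.posCone) (J : Set ι) :
    (∀ v ∈ B.fundFacet J, β v = 0) ∨ ∀ v ∈ B.fundFacet J, 0 < β v := by
  obtain ⟨c, hc, rfl⟩ := hβ
  simp only [LinearMap.sum_apply, LinearMap.smul_apply, smul_eq_mul]
  by_cases h : ∀ j ∉ J, c j = 0
  · refine Or.inl fun v hv => Finset.sum_eq_zero fun i _ => mul_eq_zero.2 ?_
    exact (em (i ∈ J)).symm.imp (h i) (hv.1 i)
  · push Not at h
    obtain ⟨j, hj, hj0⟩ := h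
    exact Or.inr fun v hv => Finset.sum_pos'
      (fun i _ => mul_nonneg (hc i) (isDominant_of_mem_fundFacet hv i))
      ⟨j, Finset.mem_univ j, mul_pos ((hc j).lt_of_ne' hj0) (hv.2 j hj)⟩

end PositiveCone

section Facets

variable {ι V : Type*} [NormedAddCommGroup V] [NormedSpace ℝ V] {B : RootBasis ι V}

theorem IsFacetOfType.exists_linearEquiv {J : Set ι} {Fv : Set V} (h : B.IsFacetOfType J Fv) :
    ∃ g : V ≃ₗ[ℝ] V, Fv = g '' B.fundFacet J ∧
      (g ∈ B.vWeyl ∨ ∃ w ∈ B.vWeyl, g = w.trans (LinearEquiv.neg ℝ)) := by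
  obtain ⟨w, hw, h | h⟩ := h
  · exact ⟨w, h, Or.inl hw⟩
  · exact ⟨w.trans (LinearEquiv.neg ℝ), h, Or.inr ⟨w, hw, rfl⟩⟩

theorem IsSphericalVFacet.isVFacet {Fv : Set V} (h : B.IsSphericalVFacet Fv) : B.IsVFacet Fv :=
  h.imp fun _ => And.right

theorem exists_isVFacet_mem {v : V} (hv : v ∈ B.titsCone ∨ -v ∈ B.titsCone) :
    ∃ Fv, B.IsVFacet Fv ∧ v ∈ Fv := by
  simp only [titsCone, mem_iUnion] at hv
  obtain ⟨w, hw, J, u, hu, h⟩ | ⟨w, hw, J, u, hu, h⟩ := hv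
  · exact ⟨_, ⟨J, w, hw, Or.inl rfl⟩, u, hu, h⟩
  · exact ⟨_, ⟨J, w, hw, Or.inr rfl⟩, u, hu, neg_eq_iff_eq_neg.2 h⟩

namespace IsVFacet

variable {Fv : Set V}

theorem exists_linearEquiv (h : B.IsVFacet Fv) :
    ∃ (g : V ≃ₗ[ℝ] V) (J : Set ι), Fv = g '' B.fundFacet J := by
  obtain ⟨J, h⟩ := h
  obtain ⟨g, hg, -⟩ := h.exists_linearEquiv
  exact ⟨g, J, hg⟩

theorem nonempty [Finite ι] (h : B.IsVFacet Fv) : Fv.Nonempty := by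
  obtain ⟨g, J, rfl⟩ := h.exists_linearEquiv
  exact (B.fundFacet_nonempty J).image _

theorem smul_mem (h : B.IsVFacet Fv) {v : V} (hv : v ∈ Fv) {t : ℝ} (ht : 0 < t) :
    t • v ∈ Fv := by
  obtain ⟨g, J, rfl⟩ := h.exists_linearEquiv
  obtain ⟨v, hv, rfl⟩ := hv
  exact ⟨t • v, B.smul_mem_fundFacet hv ht, map_smul g t v⟩

theorem zero_mem_closure [Finite ι] (h : B.IsVFacet Fv) : (0 : V) ∈ closure Fv := by
  obtain ⟨v, hv⟩ := h.nonempty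
  have hlim : Tendsto (fun t : ℝ => t • v) (𝓝[>] 0) (𝓝 0) :=
    (Continuous.tendsto' (by fun_prop) 0 0 (zero_smul ℝ v)).mono_left nhdsWithin_le_nhds
  exact mem_closure_of_tendsto hlim (eventually_nhdsWithin_of_forall fun t ht => h.smul_mem hv ht)

variable [FiniteDimensional ℝ V]

theorem add_mem (h : B.IsVFacet Fv) {u v : V} (hu : u ∈ closure Fv) (hv : v ∈ Fv) :
    u + v ∈ Fv := by
  obtain ⟨g, J, rfl⟩ := h.exists_linearEquiv
  obtain ⟨v, hv, rfl⟩ := hv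
  have hg : closure (g '' B.fundFacet J) = g '' closure (B.fundFacet J) :=
    (g.toContinuousLinearEquiv.toHomeomorph.image_closure _).symm
  rw [hg] at hu
  obtain ⟨u, hu, rfl⟩ := hu
  have hcont : ∀ i, Continuous (B.root i) := fun i => LinearMap.continuous_of_finiteDimensional _
  refine ⟨u + v, ⟨fun i hi => ?_, fun i hi => ?_⟩, map_add g u v⟩ <;> rw [map_add]
  · have hui : B.root i u = 0 := closure_minimal
      (fun x (hx : x ∈ B.fundFacet J) => hx.1 i hi) (isClosed_eq (hcont i) continuous_const) hu
    rw [hui, hv.1 i hi, add_zero]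
  · have hui : 0 ≤ B.root i u := closure_minimal
      (fun x (hx : x ∈ B.fundFacet J) => (hx.2 i hi).le)
      (isClosed_le continuous_const (hcont i)) hu
    exact add_pos_of_nonneg_of_pos hui (hv.2 i hi)

theorem add_mem_closure (h : B.IsVFacet Fv) {u v : V} (hu : u ∈ closure Fv)
    (hv : v ∈ closure Fv) : u + v ∈ closure Fv :=
  map_mem_closure₂ continuous_add hu hv fun _ hx _ hy => h.add_mem (subset_closure hx) hy

end IsVFacet

end Facets

end RootBasis

namespace ApartmentRootDatum

open RootBasis

variable {ι V : Type*} [Fintype ι] [NormedAddCommGroup V] [NormedSpace ℝ V]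
  (D : ApartmentRootDatum ι V)

section Roots

variable {D}

theorem dualAct_mem_allRoots {w : V ≃ₗ[ℝ] V} (hw : w ∈ D.vWeyl) {β : Module.Dual ℝ V}
    (hβ : β ∈ D.allRoots) : dualAct w β ∈ D.allRoots :=
  hβ.imp (D.dualAct_mem_realRoots hw) (D.imag_act w hw β)

theorem neg_mem_allRoots {β : Module.Dual ℝ V} (hβ : β ∈ D.allRoots) : -β ∈ D.allRoots :=
  hβ.imp D.neg_mem_realRoots (D.imag_neg β)

theorem mem_posCone_or_neg_mem {β : Module.Dual ℝ V} (hβ : β ∈ D.allRoots) :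
    β ∈ D.posCone ∨ -β ∈ D.posCone :=
  hβ.elim (fun h => (D.pos_or_neg β h).imp And.right And.right) (D.imag_pos_or_neg β)

theorem comp_mem_allRoots {g : V ≃ₗ[ℝ] V}
    (hg : g ∈ D.vWeyl ∨ ∃ w ∈ D.vWeyl, g = w.trans (LinearEquiv.neg ℝ)) {α : Module.Dual ℝ V}
    (hα : α ∈ D.allRoots) : α ∘ₗ g.toLinearMap ∈ D.allRoots := by
  have hcomp : ∀ w ∈ D.vWeyl, α ∘ₗ w.toLinearMap ∈ D.allRoots :=
    fun w hw => dualAct_mem_allRoots (inv_mem hw) hα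
  obtain hg | ⟨w, hw, rfl⟩ := hg
  · exact hcomp g hg
  · have : α ∘ₗ (w.trans (LinearEquiv.neg ℝ)).toLinearMap = -(α ∘ₗ w.toLinearMap) :=
      LinearMap.ext fun v => map_neg α (w v)
    exact this ▸ neg_mem_allRoots (hcomp w hw)

theorem mem_posCone_of_isDominant {α : Module.Dual ℝ V} (hα : α ∈ D.allRoots) {v : V}
    (hv : D.IsDominant v) (hpos : 0 < α v) : α ∈ D.posCone := by
  refine (mem_posCone_or_neg_mem hα).resolve_right fun hneg => ?_
  have := hv.apply_nonneg hneg
  rw [LinearMap.neg_apply] at this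
  linarith

theorem zero_or_pos_or_neg_on_facet {Fv : Set V} (hF : D.IsVFacet Fv) {α : Module.Dual ℝ V}
    (hα : α ∈ D.allRoots) :
    (∀ v ∈ Fv, α v = 0) ∨ (∀ v ∈ Fv, 0 < α v) ∨ ∀ v ∈ Fv, α v < 0 := by
  obtain ⟨J, hF⟩ := hF
  obtain ⟨g, rfl, hg⟩ := hF.exists_linearEquiv
  simp only [forall_mem_image]
  rcases mem_posCone_or_neg_mem (comp_mem_allRoots hg hα) with h | h
  · exact (eq_zero_or_pos_on_fundFacet h J).imp_right Or.inl
  · exact (eq_zero_or_pos_on_fundFacet h J).imp (fun h v hv => neg_eq_zero.1 (h v hv))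
      fun h => Or.inr fun v hv => neg_pos.1 (h v hv)

theorem dualAct_simpleRefl_mem_posCone {β : Module.Dual ℝ V} (hβ : β ∈ D.realRoots)
    (hβ' : β ∈ D.posCone) {i : ι} (hi : β ≠ D.root i) :
    dualAct (D.simpleRefl i) β ∈ D.posCone := by
  classical
  refine (D.pos_or_neg _ (D.dualAct_mem_realRoots (D.simpleRefl_mem_vWeyl i) hβ)).elim And.right
    fun hneg => (hi ?_).elim
  obtain ⟨c, hc, rfl⟩ := hβ'
  -- `r_i` changes only the coefficient of `α_i`, so all the other ones have to vanish.
  have hzero : ∀ j, j ≠ i → c j = 0 := by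
    intro j hj
    obtain ⟨v, hv⟩ := exists_forall_dual_apply_eq D.linearIndependent_root (Pi.single j 1)
    have hdom : D.IsDominant v := fun k => by rw [hv]; by_cases h : k = j <;> simp [h]
    have hcj := hdom.apply_nonneg hneg.2
    rw [LinearMap.neg_apply, dualAct_simpleRefl_apply, simpleRefl_apply, hv,
      Pi.single_eq_of_ne hj.symm, zero_smul, sub_zero] at hcj
    simp only [LinearMap.sum_apply, LinearMap.smul_apply, hv, smul_eq_mul, Pi.single_apply,
      mul_ite, mul_one, mul_zero, Finset.sum_ite_eq', Finset.mem_univ, if_true] at hcj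
    linarith [hc j]
  rw [Finset.sum_eq_single i (fun j _ hj => by rw [hzero j hj, zero_smul]) (by simp)] at hβ ⊢
  exact D.reduced _ (D.root_mem_realRoots i) _ (hc i) hβ

end Roots

section TitsCone

/-- The positive roots of `W^v(J)` which are negative at `v`. Their number measures how far
`v` is from being dominant with respect to `J`. -/
def negativeAt (J : Set ι) (v : V) : Set (Module.Dual ℝ V) :=
  {β | β ∈ D.parabolicRoots J ∧ β ∈ D.posCone ∧ β v < 0}

theorem negativeAt_simpleRefl_subset {J : Set ι} {i : ι} (hi : i ∈ J) (v : V) :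
    D.negativeAt J (D.simpleRefl i v) ⊆
      insert (D.root i) (dualAct (D.simpleRefl i) '' (D.negativeAt J v \ {D.root i})) := by
  rintro β ⟨hβJ, hβpos, hβv⟩
  by_cases hβ : β = D.root i
  · exact Or.inl hβ
  refine Or.inr ⟨dualAct (D.simpleRefl i) β, ⟨⟨?_, ?_, hβv⟩, fun h => ?_⟩,
    D.dualAct_simpleRefl_involutive i β⟩
  · exact D.dualAct_mem_parabolicRoots (D.simpleRefl_mem_parabolic hi) hβJ
  · exact dualAct_simpleRefl_mem_posCone (D.parabolicRoots_subset_realRoots J hβJ) hβpos hβ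
  · have : β = -D.root i := by
      rw [← D.dualAct_simpleRefl_involutive i β, mem_singleton_iff.1 h, dualAct_simpleRefl_root]
    exact neg_root_notMem_posCone i (this ▸ hβpos)

theorem finite_negativeAt_simpleRefl {J : Set ι} {i : ι} (hi : i ∈ J) {v : V}
    (hfin : (D.negativeAt J v).Finite) : (D.negativeAt J (D.simpleRefl i v)).Finite :=
  ((hfin.sdiff.image _).insert _).subset (D.negativeAt_simpleRefl_subset hi v)

theorem ncard_negativeAt_simpleRefl_lt {J : Set ι} {i : ι} (hi : i ∈ J) {v : V}
    (hfin : (D.negativeAt J v).Finite) (hv : D.root i v < 0) :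
    (D.negativeAt J (D.simpleRefl i v)).ncard < (D.negativeAt J v).ncard := by
  have hsub : D.negativeAt J (D.simpleRefl i v) ⊆
      dualAct (D.simpleRefl i) '' (D.negativeAt J v \ {D.root i}) := fun β hβ => by
    refine (D.negativeAt_simpleRefl_subset hi v hβ).resolve_left ?_
    rintro rfl
    have := hβ.2.2
    rw [root_simpleRefl] at this
    linarith
  have hmem : D.root i ∈ D.negativeAt J v :=
    ⟨D.root_mem_parabolicRoots hi, D.root_mem_posCone i, hv⟩
  calc (D.negativeAt J (D.simpleRefl i v)).ncard
    _ ≤ (dualAct (D.simpleRefl i) '' (D.negativeAt J v \ {D.root i})).ncard :=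
      ncard_le_ncard hsub (hfin.sdiff.image _)
    _ = (D.negativeAt J v \ {D.root i}).ncard := ncard_image_of_injective _ (dualAct_injective _)
    _ < (D.negativeAt J v).ncard := ncard_sdiff_singleton_lt_of_mem hmem hfin

theorem exists_parabolic_forall_root_nonneg {J : Set ι} {v : V}
    (hfin : (D.negativeAt J v).Finite) : ∃ w ∈ D.parabolic J, ∀ i ∈ J, 0 ≤ D.root i (w v) := by
  induction hn : (D.negativeAt J v).ncard using Nat.strong_induction_on generalizing v with
  | _ n ih =>
    subst hn
    by_cases! hdom : ∀ i ∈ J, 0 ≤ D.root i v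
    · exact ⟨1, one_mem _, hdom⟩
    obtain ⟨i, hi, hiv⟩ := hdom
    obtain ⟨w, hw, hdom⟩ := ih _ (D.ncard_negativeAt_simpleRefl_lt hi hfin hiv)
      (D.finite_negativeAt_simpleRefl hi hfin) rfl
    exact ⟨w * D.simpleRefl i, mul_mem hw (D.simpleRefl_mem_parabolic hi), hdom⟩

theorem finite_negativeAt_map {w : V ≃ₗ[ℝ] V} (hw : w ∈ D.vWeyl) {v : V}
    (hfin : (D.negativeAt univ v).Finite) : (D.negativeAt univ (w v)).Finite := by
  induction hw using Subgroup.closure_induction_left with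
  | one => exact hfin
  | mul_left x hx y _ ih =>
    obtain ⟨i, rfl⟩ := hx
    exact D.finite_negativeAt_simpleRefl (mem_univ i) ih
  | inv_mul_cancel x hx y _ ih =>
    obtain ⟨i, rfl⟩ := hx
    exact D.finite_negativeAt_simpleRefl (mem_univ i) ih

theorem mem_titsCone_iff_finite_negativeAt {v : V} :
    v ∈ D.titsCone ↔ (D.negativeAt univ v).Finite := by
  rw [mem_titsCone_iff_exists_isDominant]
  constructor
  · rintro ⟨w, hw, hv⟩
    have hempty : D.negativeAt univ (w v) = ∅ :=
      eq_empty_of_forall_notMem fun β hβ => hβ.2.2.not_ge (hv.apply_nonneg hβ.2.1)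
    have := D.finite_negativeAt_map (inv_mem hw) (hempty ▸ finite_empty)
    rwa [← LinearEquiv.mul_apply, inv_mul_cancel] at this
  · intro hfin
    obtain ⟨w, hw, hv⟩ := D.exists_parabolic_forall_root_nonneg hfin
    exact ⟨w, D.parabolic_univ ▸ hw, fun i => hv i (mem_univ i)⟩

theorem add_mem_titsCone {u v : V} (hu : u ∈ D.titsCone) (hv : v ∈ D.titsCone) :
    u + v ∈ D.titsCone := by
  rw [mem_titsCone_iff_finite_negativeAt] at hu hv ⊢
  refine (hu.union hv).subset fun β ⟨hβ, hβpos, hβuv⟩ => ?_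
  rw [map_add] at hβuv
  rcases lt_or_ge (β u) 0 with h | h
  · exact Or.inl ⟨hβ, hβpos, h⟩
  · exact Or.inr ⟨hβ, hβpos, by linarith⟩

/-- The Tits cone, as a bundled convex cone. -/
def titsPointedCone : PointedCone ℝ V where
  carrier := D.titsCone
  add_mem' := D.add_mem_titsCone
  zero_mem' := D.mem_titsCone_iff_exists_isDominant.2
    ⟨1, one_mem _, fun i => (map_zero (D.root i)).ge⟩
  smul_mem' := by
    rintro ⟨c, hc⟩ v hv
    obtain ⟨w, hw, hv⟩ := D.mem_titsCone_iff_exists_isDominant.1 hv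
    refine D.mem_titsCone_iff_exists_isDominant.2 ⟨w, hw, fun i => ?_⟩
    rw [Nonneg.mk_smul, map_smul, map_smul]
    exact mul_nonneg hc (hv i)

theorem map_mem_interior_titsPointedCone [FiniteDimensional ℝ V] {w : V ≃ₗ[ℝ] V}
    (hw : w ∈ D.vWeyl) {v : V} (hv : v ∈ interiorPointedCone D.titsPointedCone) :
    w v ∈ interiorPointedCone D.titsPointedCone :=
  map_mem_interiorPointedCone (g := w.toContinuousLinearEquiv) (fun _ => D.map_mem_titsCone hw) hv

end TitsCone

section Spherical

theorem exists_isDominant_add_smul {J : Set ι} (hJ : D.IsSphericalType J) {η : V}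
    (hη : η ∈ D.fundFacet J) (u : V) :
    ∃ t : ℝ, ∃ w ∈ D.parabolic J, D.IsDominant (w (u + t • η)) := by
  obtain ⟨w, hw, hwu⟩ := D.exists_parabolic_forall_root_nonneg (v := u)
    (hJ.finite_parabolicRoots.subset fun β hβ => hβ.1)
  have hwη : w η = η := D.apply_eq_self_of_mem_parabolic hw hη.1
  have hlarge : ∀ i, ∀ᶠ t : ℝ in atTop, 0 ≤ D.root i (w u) + t * D.root i η := fun i => by
    by_cases hi : i ∈ J
    · simp only [hη.1 i hi, mul_zero, add_zero, hwu i hi, eventually_true]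
    · exact (tendsto_atTop_add_const_left _ _
        (tendsto_id.atTop_mul_const (hη.2 i hi))).eventually_ge_atTop 0
  obtain ⟨t, ht⟩ := (eventually_all.2 hlarge).exists
  refine ⟨t, w, hw, fun i => ?_⟩
  simpa only [map_add, map_smul, hwη, smul_eq_mul] using ht i

theorem exists_add_smul_nonneg_of_mem_fundFacet {J : Set ι} (hJ : D.IsSphericalType J) {η : V}
    (hη : η ∈ D.fundFacet J) (u : V) :
    ∃ t : ℝ, ∀ α ∈ D.allRoots, 0 < α η → 0 ≤ α (u + t • η) := by
  obtain ⟨t, w, hw, hdom⟩ := D.exists_isDominant_add_smul hJ hη u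
  refine ⟨t, fun α hα hpos => ?_⟩
  have hwη : w η = η := D.apply_eq_self_of_mem_parabolic hw hη.1
  have hwα : dualAct w α ∈ D.posCone := by
    refine mem_posCone_of_isDominant (dualAct_mem_allRoots (D.parabolic_le_vWeyl J hw) hα)
      (isDominant_of_mem_fundFacet hη) ?_
    rwa [← hwη, dualAct_apply_apply]
  rw [← dualAct_apply_apply w α]
  exact hdom.apply_nonneg hwα

theorem exists_add_smul_nonneg {Fv : Set V} (hF : D.IsSphericalVFacet Fv) {η : V} (hη : η ∈ Fv)
    (u : V) : ∃ t : ℝ, ∀ α ∈ D.allRoots, 0 < α η → 0 ≤ α (u + t • η) := by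
  obtain ⟨J, hJ, hF⟩ := hF
  obtain ⟨g, rfl, hg⟩ := hF.exists_linearEquiv
  obtain ⟨η, hη, rfl⟩ := hη
  obtain ⟨t, h⟩ := D.exists_add_smul_nonneg_of_mem_fundFacet hJ hη (g.symm u)
  refine ⟨t, fun α hα hpos => ?_⟩
  simpa only [LinearMap.comp_apply, LinearEquiv.coe_coe, map_add, map_smul,
    LinearEquiv.apply_symm_apply] using h _ (comp_mem_allRoots hg hα) hpos

end Spherical

end ApartmentRootDatum

namespace ModelApartment

variable {ι V : Type*} [Fintype ι] [NormedAddCommGroup V] [NormedSpace ℝ V]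
  {D : ApartmentRootDatum ι V} {P : Type*} [MetricSpace P] [NormedAddTorsor V P]
  {𝔸 : ModelApartment D P}

theorem linear_mem_vWeyl {w : P ≃ᵃ[ℝ] P} (hw : w ∈ 𝔸.weyl) : w.linear ∈ D.vWeyl := by
  suffices 𝔸.weyl ≤ D.vWeyl.comap AffineEquiv.linearHom from this hw
  refine (Subgroup.closure_le _).2 ?_
  rintro _ ⟨w, hw, i, p, -, rfl⟩
  exact mul_mem (mul_mem hw (D.simpleRefl_mem_vWeyl i)) (inv_mem hw)

section HalfSpaces

variable {α : Module.Dual ℝ V} {H : Set P}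

theorem eq_univ_or_exists_closedHalf (hH : H ∈ 𝔸.closedHalves α) :
    H = univ ∨ ∃ p, H = closedHalf α p :=
  hH.imp_right fun ⟨p, _, hp⟩ => ⟨p, hp⟩

theorem isClosed_of_mem_closedHalves [FiniteDimensional ℝ V] (hH : H ∈ 𝔸.closedHalves α) :
    IsClosed H := by
  obtain rfl | ⟨p, rfl⟩ := eq_univ_or_exists_closedHalf hH
  · exact isClosed_univ
  · have hα : Continuous α := LinearMap.continuous_of_finiteDimensional _
    exact isClosed_le continuous_const (hα.comp (continuous_id.vsub continuous_const))

theorem vadd_mem_closedHalf (hH : H ∈ 𝔸.closedHalves α) {v : V} (hv : 0 ≤ α v) {q : P}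
    (hq : q ∈ H) : v +ᵥ q ∈ H := by
  obtain rfl | ⟨p, rfl⟩ := eq_univ_or_exists_closedHalf hH
  · exact mem_univ _
  · rw [closedHalf, mem_ofPred_eq, vadd_vsub_assoc, map_add]
    exact add_nonneg hv hq

theorem eq_univ_of_ray_subset (hH : H ∈ 𝔸.closedHalves α) {η : V} (hη : α η < 0) {q : P}
    (hray : ∀ t > (0 : ℝ), t • η +ᵥ q ∈ H) : H = univ := by
  refine (eq_univ_or_exists_closedHalf hH).resolve_right ?_
  rintro ⟨p, rfl⟩
  have hlim : Tendsto (fun t : ℝ => t * α η + α (q -ᵥ p)) atTop atBot :=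
    tendsto_atBot_add_const_right _ _ (tendsto_id.atTop_mul_const_of_neg hη)
  obtain ⟨t, htq, ht⟩ := ((hlim.eventually_lt_atBot 0).and (eventually_gt_atTop 0)).exists
  have := hray t ht
  rw [closedHalf, mem_ofPred_eq, vadd_vsub_assoc, map_add, map_smul, smul_eq_mul] at this
  linarith

end HalfSpaces

section Germs

theorem le_cl (F : Filter P) : F ≤ 𝔸.cl F :=
  fun _ ⟨_, _, hF, hsub⟩ => mem_of_superset hF hsub

theorem cl_mono {F G : Filter P} (h : F ≤ G) : 𝔸.cl F ≤ 𝔸.cl G :=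
  fun _ ⟨H, hH, hG, hsub⟩ => ⟨H, hH, h hG, hsub⟩

theorem localFacet_le_facet (x : P) (Fv : Set V) : localFacet x Fv ≤ 𝔸.facet x Fv :=
  fun _ ⟨_, _, hF, hsub⟩ => mem_of_superset hF hsub

theorem pure_le_facet {Fv : Set V} (h0 : (0 : V) ∈ Fv) (x : P) : pure x ≤ 𝔸.facet x Fv :=
  (pure_le_nhdsWithin (s := (fun v : V => v +ᵥ x) '' Fv) ⟨0, h0, zero_vadd V x⟩).trans
    (localFacet_le_facet x Fv)

theorem facet_le_cl_point {Fv : Set V} (hF : D.IsVFacet Fv) (h0 : (0 : V) ∈ Fv) (x : P) :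
    𝔸.facet x Fv ≤ 𝔸.cl (𝓟 {x}) := by
  rintro S ⟨H, hH, hx, hsub⟩
  refine ⟨H, fun α hα => 𝔸.closedHalves_subset α (hH α hα), ?_, hsub⟩
  have hxH := mem_iInter₂.1 (mem_principal.1 hx (mem_singleton x))
  refine mem_of_superset self_mem_nhdsWithin ?_
  rintro _ ⟨v, hv, rfl⟩
  refine mem_iInter₂.2 fun α hα => vadd_mem_closedHalf (hH α hα) ?_ (hxH α hα)
  -- No root is positive or negative on `F^v`, since all roots vanish at `0 ∈ F^v`.
  obtain h | h | h := ApartmentRootDatum.zero_or_pos_or_neg_on_facet hF hα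
  · exact (h v hv).ge
  · exact ((h 0 h0).ne' (map_zero α)).elim
  · exact ((h 0 h0).ne (map_zero α)).elim

theorem facet_neBot {Fv : Set V} (hF : D.IsVFacet Fv) (x : P) : (𝔸.facet x Fv).NeBot := by
  have hx : x ∈ closure ((fun v : V => v +ᵥ x) '' Fv) := by
    have hcont : Continuous fun v : V => v +ᵥ x := continuous_id.vadd continuous_const
    have := image_closure_subset_closure_image hcont (mem_image_of_mem _ hF.zero_mem_closure)
    simpa only [zero_vadd] using this
  have : (localFacet x Fv).NeBot := mem_closure_iff_nhdsWithin_neBot.1 hx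
  exact this.mono (localFacet_le_facet x Fv)

theorem intervalGerm_le_facet {x y : P} {Fv : Set V} (hF : D.IsVFacet Fv) (h : y -ᵥ x ∈ Fv) :
    intervalGerm x y ≤ 𝔸.facet x Fv := by
  refine (nhdsWithin_mono x ?_).trans (localFacet_le_facet x Fv)
  rintro _ ⟨t, ht, rfl⟩
  exact ⟨t • (y -ᵥ x), hF.smul_mem h ht.1, (AffineMap.lineMap_apply x y t).symm⟩

theorem intervalGerm_self (x : P) : intervalGerm x x = 𝓟 {x} := by
  have : AffineMap.lineMap x x '' Ioc (0 : ℝ) 1 = {x} := by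
    rw [AffineMap.lineMap_same]
    exact (nonempty_Ioc.2 zero_lt_one).image_const x
  rw [intervalGerm, this, nhdsWithin_singleton, principal_singleton]

theorem tendsto_lineMap_cl_intervalGerm [FiniteDimensional ℝ V] (x y : P) :
    Tendsto (AffineMap.lineMap x y : ℝ → P) (𝓝[≥] 0) (𝔸.cl (intervalGerm x y)) := by
  have hlim : Tendsto (AffineMap.lineMap x y : ℝ → P) (𝓝[>] 0) (intervalGerm x y) := by
    refine tendsto_nhdsWithin_iff.2 ⟨?_, ?_⟩
    · exact (AffineMap.lineMap_continuous.tendsto' 0 x (AffineMap.lineMap_apply_zero x y)).mono_left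
        nhdsWithin_le_nhds
    · filter_upwards [Ioc_mem_nhdsGT zero_lt_one] with t ht using mem_image_of_mem _ ht
  rw [← nhdsGT_sup_nhdsWithin_singleton, nhdsWithin_singleton]
  refine (hlim.mono_right (le_cl _)).sup (tendsto_pure_left.2 ?_)
  rintro T ⟨H, hH, hG, hsub⟩
  have hclosed : IsClosed (⋂ α ∈ D.allRoots, H α) :=
    isClosed_biInter fun α hα => isClosed_of_mem_closedHalves (hH α hα)
  rw [AffineMap.lineMap_apply_zero]
  exact hsub (hclosed.mem_of_tendsto (hlim.mono_right nhdsWithin_le_nhds) (hlim.eventually hG))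

end Germs

section Chimneys

variable {x : P} {F₀ Fv : Set V}

theorem exists_smul_vadd_mem_iInter (hFv : D.IsSphericalVFacet Fv) {η : V} (hη : η ∈ Fv)
    {H : Module.Dual ℝ V → Set P} (hH : ∀ α ∈ D.allRoots, H α ∈ 𝔸.closedHalves α) {b : P}
    (hb : ∀ v ∈ Fv, v +ᵥ b ∈ ⋂ α ∈ D.allRoots, H α) {q : P}
    (hq : ∀ α ∈ D.allRoots, (∀ v ∈ Fv, α v = 0) → q ∈ H α) :
    ∃ t : ℝ, t • η +ᵥ q ∈ ⋂ α ∈ D.allRoots, H α := by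
  obtain ⟨t, hnonneg⟩ := D.exists_add_smul_nonneg hFv hη (q -ᵥ (η +ᵥ b))
  refine ⟨t, mem_iInter₂.2 fun α hα => ?_⟩
  obtain h0 | hpos | hneg := ApartmentRootDatum.zero_or_pos_or_neg_on_facet hFv.isVFacet hα
  · exact vadd_mem_closedHalf (hH α hα) (by rw [map_smul, h0 η hη, smul_zero]) (hq α hα h0)
  · have hqb : t • η +ᵥ q = ((q -ᵥ (η +ᵥ b)) + t • η) +ᵥ (η +ᵥ b) := by
      rw [add_comm, add_vadd, vsub_vadd]
    rw [hqb]
    exact vadd_mem_closedHalf (hH α hα) (hnonneg α hα (hpos η hη)) (mem_iInter₂.1 (hb η hη) α hα)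
  · rw [eq_univ_of_ray_subset (hH α hα) (hneg η hη) fun s hs =>
      mem_iInter₂.1 (hb _ (hFv.isVFacet.smul_mem hη hs)) α hα]
    exact mem_univ _

variable [FiniteDimensional ℝ V]

theorem shiftedChimney_add_le (hFv : D.IsVFacet Fv) (ξ : V) {ζ : V} (hζ : ζ ∈ closure Fv) :
    𝔸.shiftedChimney x F₀ Fv (ξ + ζ) ≤ 𝔸.shiftedChimney x F₀ Fv ξ := by
  refine cl_mono fun S hS => eventually_map₂_principal.2 ?_
  filter_upwards [eventually_map₂_principal.1 hS] with p hp v hv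
  have hv' : v +ᵥ ((ξ + ζ) +ᵥ p) = (ζ + v) +ᵥ (ξ +ᵥ p) := by
    rw [vadd_vadd, vadd_vadd]
    congr 1
    abel
  exact hv' ▸ hp (ζ + v) (hFv.add_mem hζ hv)

theorem mem_chimneyGerm_iff (hFv : D.IsVFacet Fv) {T : Set P} :
    T ∈ 𝔸.chimneyGerm x F₀ Fv ↔ ∃ ξ ∈ closure Fv, T ∈ 𝔸.shiftedChimney x F₀ Fv ξ := by
  refine mem_biInf_of_directed (fun ξ hξ ζ hζ => ⟨ξ + ζ, hFv.add_mem_closure hξ hζ,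
    shiftedChimney_add_le hFv ξ hζ, ?_⟩) ⟨0, hFv.zero_mem_closure⟩
  exact add_comm ζ ξ ▸ shiftedChimney_add_le hFv ζ hξ

theorem setOf_vanishing_mem_chimney {ξ : V} (hξ : ξ ∈ closure Fv)
    {H : Module.Dual ℝ V → Set P} (hH : ∀ α ∈ D.allRoots, H α ∈ 𝔸.closedHalves α)
    (hmem : ∀ᶠ p in 𝔸.facet x F₀, ∀ v ∈ Fv, v +ᵥ (ξ +ᵥ p) ∈ ⋂ α ∈ D.allRoots, H α) :
    {q | ∀ α ∈ D.allRoots, (∀ v ∈ Fv, α v = 0) → q ∈ H α} ∈ 𝔸.chimney x F₀ Fv := by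
  classical
  refine ⟨fun α => if ∀ v ∈ Fv, α v = 0 then H α else univ, fun α hα => ?_, ?_,
    fun q hq α hα hα0 => ?_⟩
  · dsimp only
    split_ifs
    exacts [hH α hα, Or.inl rfl]
  · refine eventually_map₂_principal.2 (hmem.mono fun p hp v hv => mem_iInter₂.2 fun α hα => ?_)
    dsimp only
    split_ifs with hα0
    · have hξ0 : α ξ = 0 := closure_minimal (t := {u | α u = 0}) hα0
        (isClosed_eq (LinearMap.continuous_of_finiteDimensional _) continuous_const) hξ
      have hshift : v +ᵥ p = -ξ +ᵥ (v +ᵥ (ξ +ᵥ p)) := by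
        rw [vadd_comm v ξ p, neg_vadd_vadd]
      rw [hshift]
      exact vadd_mem_closedHalf (hH α hα) (by rw [map_neg, hξ0, neg_zero])
        (mem_iInter₂.1 (hp v hv) α hα)
    · exact mem_univ _
  · simpa only [if_pos hα0] using mem_iInter₂.1 hq α hα

theorem mem_chimney_of_mem_chimneyGerm (hF₀ : D.IsVFacet F₀) (hFv : D.IsSphericalVFacet Fv)
    {E : AffineSubspace ℝ P} (hE : (E : Set P) ∈ 𝔸.chimneyGerm x F₀ Fv) :
    (E : Set P) ∈ 𝔸.chimney x F₀ Fv := by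
  obtain ⟨ξ, hξ, H, hH, hmem, hHE⟩ := (mem_chimneyGerm_iff hFv.isVFacet).1 hE
  have hmem := eventually_map₂_principal.1 hmem
  have := facet_neBot (𝔸 := 𝔸) hF₀ x
  obtain ⟨b, hb⟩ := hmem.exists
  obtain ⟨η, hη⟩ := hFv.isVFacet.nonempty
  have hηdir : η ∈ E.direction := by
    have := AffineSubspace.vsub_mem_direction
      (hHE (hb _ (hFv.isVFacet.smul_mem hη two_pos))) (hHE (hb η hη))
    rwa [vadd_vsub_vadd_cancel_right, two_smul, add_sub_cancel_right] at this
  -- Far enough in the direction `η`, such a point satisfies the other constraints as well.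
  refine mem_of_superset (setOf_vanishing_mem_chimney hξ hH hmem) fun q hq => ?_
  obtain ⟨t, ht⟩ := exists_smul_vadd_mem_iInter hFv hη hH hb hq
  exact (AffineSubspace.vadd_mem_iff_mem_of_mem_direction (E.direction.smul_mem t hηdir)).1
    (hHE ht)

theorem IsFullFlaredChimneyGerm.eq_of_eqOn {G : Filter P} (hG : 𝔸.IsFullFlaredChimneyGerm G)
    {T : Set P} (hT : T ∈ G) {W Q : Type*} [AddCommGroup W] [Module ℝ W] [AddTorsor W Q]
    {f g : P →ᵃ[ℝ] Q} (hfg : EqOn f g T) : f = g := by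
  obtain ⟨x, F₀, Fv, hF₀, hFv, hfull, rfl⟩ := hG
  have hspan : (affineSpan ℝ T : Set P) ∈ 𝔸.chimneyGerm x F₀ Fv :=
    mem_of_superset hT (subset_affineSpan ℝ T)
  refine AffineMap.ext_on (eq_top_iff.2 ?_) hfg
  exact hfull ▸ sInf_le (mem_chimney_of_mem_chimneyGerm hF₀ hFv hspan)

end Chimneys

theorem IsFullFlaredChimneyGerm.isFlaredChimneyGerm {G : Filter P}
    (hG : 𝔸.IsFullFlaredChimneyGerm G) : 𝔸.IsFlaredChimneyGerm G :=
  let ⟨x, F₀, Fv, hF₀, hFv, _, h⟩ := hG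
  ⟨x, F₀, Fv, hF₀, hFv, h⟩

theorem IsFullFlaredChimneyGerm.isSolidChimneyGerm {G : Filter P}
    (hG : 𝔸.IsFullFlaredChimneyGerm G) : 𝔸.IsSolidChimneyGerm G := by
  obtain ⟨x, F₀, Fv, hF₀, hFv, hfull, rfl⟩ := hG
  refine ⟨x, F₀, Fv, hF₀, hFv.isVFacet, (finite_singleton 1).subset fun w hw => ?_, rfl⟩
  refine LinearEquiv.ext fun v => hw.2 v ?_
  rw [hfull, AffineSubspace.direction_top]
  exact Submodule.mem_top

end ModelApartment

namespace ApartmentSystem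

section Push

variable {P X : Type*} {A : Set X} (f : P ≃ A)

theorem coe_equiv_injective : Function.Injective fun p => (f p : X) :=
  Subtype.val_injective.comp f.injective

theorem mem_push_self (G : Filter P) : A ∈ push f G :=
  mem_map.2 (mem_of_superset univ_mem fun p _ => (f p).2)

theorem comap_push (G : Filter P) : (push f G).comap (fun p => (f p : X)) = G :=
  comap_map (coe_equiv_injective f)

theorem push_comap {F : Filter X} (hF : A ∈ F) : push f (F.comap fun p => (f p : X)) = F := by
  refine map_comap_of_mem (mem_of_superset hF fun x hx => ?_)
  exact ⟨f.symm ⟨x, hx⟩, congrArg Subtype.val (f.apply_symm_apply _)⟩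

end Push

section Fixes

variable {X : Type*} {A A' A'' : Set X} {F F' : Filter X} {φ : A ≃ A'} {ψ : A' ≃ A''}

theorem Fixes.mono (h : F ≤ F') (hφ : Fixes φ F') : Fixes φ F :=
  let ⟨T, hT, hfix⟩ := hφ
  ⟨T, h hT, hfix⟩

theorem Fixes.symm (hA : A ∈ F) (hφ : Fixes φ F) : Fixes φ.symm F := by
  obtain ⟨T, hT, hfix⟩ := hφ
  refine ⟨T ∩ A, inter_mem hT hA, fun a ha => ?_⟩
  have hφa : φ ⟨a, ha.2⟩ = a := Subtype.ext (hfix _ ha.1)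
  rw [φ.symm_apply_eq.2 hφa.symm]

theorem Fixes.trans (hφ : Fixes φ F) (hψ : Fixes ψ F) : Fixes (φ.trans ψ) F := by
  obtain ⟨T, hT, hφ⟩ := hφ
  obtain ⟨U, hU, hψ⟩ := hψ
  refine ⟨T ∩ U, inter_mem hT hU, fun a ha => ?_⟩
  have hφa : (φ a : X) = a := hφ a ha.1
  exact (hψ (φ a) (hφa ▸ ha.2)).trans hφa

end Fixes

variable {ι V : Type*} [Fintype ι] [NormedAddCommGroup V] [NormedSpace ℝ V]
  {D : ApartmentRootDatum ι V} {P : Type*} [MetricSpace P] [NormedAddTorsor V P]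
  {𝔸 : ModelApartment D P} {X : Type*} {S : ApartmentSystem 𝔸 X} {A A' A'' : Set X}

theorem IsKindIn.mono {K K' : Filter P → Prop} (h : ∀ G, K G → K' G) {F : Filter X}
    (hF : S.IsKindIn K A F) : S.IsKindIn K' A F :=
  let ⟨f, hf, G, hG, hFG⟩ := hF
  ⟨f, hf, G, h G hG, hFG⟩

theorem IsKindIn.mem {K : Filter P → Prop} {F : Filter X} (hF : S.IsKindIn K A F) : A ∈ F := by
  obtain ⟨f, -, G, -, rfl⟩ := hF
  exact mem_push_self f G

section Isomorphisms

variable {φ : A ≃ A'} {ψ : A' ≃ A''}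

theorem IsIso.trans_mem_isom (hA : A ∈ S.apartments) (hA' : A' ∈ S.apartments)
    (hφ : S.IsIso φ) {f : P ≃ A} (hf : f ∈ S.isom A) : f.trans φ ∈ S.isom A' := by
  obtain ⟨f₀, hf₀, h₀⟩ := hφ
  obtain ⟨w, hw, h⟩ := (S.isom_iff A hA f₀ hf₀ f).1 hf
  exact (S.isom_iff A' hA' _ h₀ _).2 ⟨w, hw, fun p => congrArg φ (h p)⟩

theorem IsIso.symm (hφ : S.IsIso φ) : S.IsIso φ.symm := by
  obtain ⟨f, hf, h⟩ := hφ
  refine ⟨f.trans φ, h, ?_⟩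
  rwa [Equiv.trans_assoc, Equiv.self_trans_symm, Equiv.trans_refl]

theorem IsIso.trans (hA' : A' ∈ S.apartments) (hA'' : A'' ∈ S.apartments) (hφ : S.IsIso φ)
    (hψ : S.IsIso ψ) : S.IsIso (φ.trans ψ) :=
  let ⟨f, hf, h⟩ := hφ
  ⟨f, hf, hψ.trans_mem_isom hA' hA'' h⟩

theorem EnclosureShared.exists_isIso_fixes_push_cl {f : P ≃ A} (hf : f ∈ S.isom A)
    {G : Filter P} (h : S.EnclosureShared A A' (push f G)) :
    ∃ φ : A ≃ A', S.IsIso φ ∧ Fixes φ (push f (𝔸.cl G)) := by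
  simpa only [comap_push] using (h f hf).2

theorem EnclosureShared.exists_isIso_fixes (hA : A ∈ S.apartments) {F : Filter X} (hF : A ∈ F)
    (h : S.EnclosureShared A A' F) : ∃ φ : A ≃ A', S.IsIso φ ∧ Fixes φ F := by
  obtain ⟨f, hf⟩ := S.isom_nonempty A hA
  obtain ⟨-, φ, hφ, hfix⟩ := h f hf
  refine ⟨φ, hφ, hfix.mono ?_⟩
  exact (push_comap f hF).ge.trans (map_mono (ModelApartment.le_cl _))

variable [FiniteDimensional ℝ V] {R : Filter X}

theorem IsIso.eq_refl_of_fixes {φ : A ≃ A} (hA : A ∈ S.apartments)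
    (hR : S.IsKindIn 𝔸.IsFullFlaredChimneyGerm A R) (hφ : S.IsIso φ) (hfix : Fixes φ R) :
    φ = Equiv.refl A := by
  obtain ⟨f, hf, G, hG, rfl⟩ := hR
  obtain ⟨T, hT, hfix⟩ := hfix
  obtain ⟨w, -, hw⟩ := (S.isom_iff A hA f hf _).1 (hφ.trans_mem_isom hA hA hf)
  have hw1 : (w : P →ᵃ[ℝ] P) = AffineMap.id ℝ P := by
    refine hG.eq_of_eqOn (mem_map.1 hT) fun p hp => coe_equiv_injective f ?_
    exact (congrArg Subtype.val (hw p)).symm.trans (hfix (f p) hp)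
  refine Equiv.ext fun a => ?_
  obtain ⟨p, rfl⟩ := f.surjective a
  exact (hw p).trans (congrArg f (DFunLike.congr_fun hw1 p))

theorem IsIso.eq_of_fixes (hA : A ∈ S.apartments) (hA' : A' ∈ S.apartments)
    (hR : S.IsKindIn 𝔸.IsFullFlaredChimneyGerm A' R) (hAR : A ∈ R) {φ ψ : A ≃ A'}
    (hφ : S.IsIso φ) (hφR : Fixes φ R) (hψ : S.IsIso ψ) (hψR : Fixes ψ R) : φ = ψ := by
  have := (hφ.symm.trans hA hA' hψ).eq_refl_of_fixes hA' hR ((hφR.symm hAR).trans hψR)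
  exact Equiv.ext fun a => by simpa using (DFunLike.congr_fun this (φ a)).symm

end Isomorphisms

section Segments

theorem seg_eq (hA : A ∈ S.apartments) {f : P ≃ A} (hf : f ∈ S.isom A) (p q : P) :
    S.seg A (f p) (f q) = (fun r => (f r : X)) '' affineSegment ℝ p q := by
  refine Subset.antisymm ?_ ?_
  · rintro _ ⟨g, hg, p', q', r, hp, hq, hr, rfl⟩
    obtain ⟨w, -, hgw⟩ := (S.isom_iff A hA f hf g).1 hg
    rw [hgw] at hp hq
    rw [← coe_equiv_injective f hp, ← coe_equiv_injective f hq, hgw]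
    refine mem_image_of_mem _ ?_
    exact affineSegment_image (w : P →ᵃ[ℝ] P) p' q' ▸ mem_image_of_mem w hr
  · rintro _ ⟨r, hr, rfl⟩
    exact ⟨f, hf, p, q, r, rfl, rfl, hr, rfl⟩

theorem image_seg_of_eqOn (hA : A ∈ S.apartments) (hA' : A' ∈ S.apartments) {f : P ≃ A'}
    (hf : f ∈ S.isom A') {g : P ≃ A} (hg : g ∈ S.isom A) {ρ : X → A} {p q : P}
    (h : EqOn (fun r => ρ (f r)) g (affineSegment ℝ p q)) :
    (fun u => (ρ u : X)) '' S.seg A' (f p) (f q) = S.seg A (ρ (f p)) (ρ (f q)) := by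
  have hp : ρ (f p) = g p := h (left_mem_affineSegment ℝ p q)
  have hq : ρ (f q) = g q := h (right_mem_affineSegment ℝ p q)
  rw [seg_eq hA' hf, hp, hq, seg_eq hA hg, image_image]
  exact image_congr fun r hr => congrArg Subtype.val (h hr)

variable {x y : X} {n : ℕ} {z : Fin (n + 1) → X}

theorem IsSubdivision.apply_zero (hz : S.IsSubdivision A x y z) : z 0 = x := by
  obtain ⟨f, -, p, q, rfl, -, t, -, h0, -, hz⟩ := hz
  rw [hz, h0, AffineMap.lineMap_apply_zero]

theorem IsSubdivision.apply_last (hz : S.IsSubdivision A x y z) : z (Fin.last n) = y := by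
  obtain ⟨f, -, p, q, -, rfl, t, -, -, h1, hz⟩ := hz
  rw [hz, h1, AffineMap.lineMap_apply_one]

theorem IsSubdivision.seg_eq_iUnion (hA : A ∈ S.apartments) (hz : S.IsSubdivision A x y z) :
    S.seg A x y = ⋃ i : Fin n, S.seg A (z i.castSucc) (z i.succ) := by
  obtain ⟨f, hf, p, q, rfl, rfl, t, ht, h0, h1, hz⟩ := hz
  obtain _ | n := n
  · exact (zero_ne_one (h0.symm.trans h1)).elim
  have hpiece : ∀ i : Fin (n + 1), S.seg A (z i.castSucc) (z i.succ) =
      (fun s : ℝ => (f (AffineMap.lineMap p q s) : X)) '' Icc (t i.castSucc) (t i.succ) :=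
    fun i => by
      rw [hz, hz, seg_eq hA hf, affineSegment_lineMap p q (ht i.castSucc_le_succ), image_image]
  simp only [hpiece]
  rw [← image_iUnion, iUnion_Icc_castSucc_succ ht, h0, h1, seg_eq hA hf, affineSegment, image_image]

theorem IsSubdivision.mapsToIncreasingBrokenLine (hA' : A' ∈ S.apartments)
    (hz : S.IsSubdivision A' x y z) {ρ : X → A} {rel : X → X → Prop}
    (h : ∀ i : Fin n, (fun u => (ρ u : X)) '' S.seg A' (z i.castSucc) (z i.succ) =
      S.seg A (ρ (z i.castSucc)) (ρ (z i.succ)) ∧ rel (ρ (z i.castSucc)) (ρ (z i.succ))) :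
    S.MapsToIncreasingBrokenLine A A' ρ rel x y := by
  refine ⟨n, z, hz, ?_, h⟩
  rw [hz.seg_eq_iUnion hA', image_iUnion]
  exact iUnion_congr fun i => (h i).1

end Segments

section ConeRel

/-- The relation `y - x ∈ C` transported to the apartment `A`. For a cone `C` stable under `W^v`
it does not depend on the chosen isomorphism; the Tits cone gives `≤_A`, and its interior together
with the origin gives `≤°_A`. -/
def coneRel (S : ApartmentSystem 𝔸 X) (C : PointedCone ℝ V) (A : Set X) (x y : X) : Prop :=
  ∃ f ∈ S.isom A, ∃ p q : P, (f p : X) = x ∧ (f q : X) = y ∧ q -ᵥ p ∈ C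

variable {C : PointedCone ℝ V}

theorem coneRel_iff (hC : ∀ w ∈ D.vWeyl, ∀ v ∈ C, w v ∈ C) (hA : A ∈ S.apartments) {f : P ≃ A}
    (hf : f ∈ S.isom A) (p q : P) : S.coneRel C A (f p) (f q) ↔ q -ᵥ p ∈ C := by
  refine ⟨?_, fun h => ⟨f, hf, p, q, rfl, rfl, h⟩⟩
  rintro ⟨g, hg, p', q', hp, hq, h⟩
  obtain ⟨w, hw, hgw⟩ := (S.isom_iff A hA f hf g).1 hg
  rw [hgw] at hp hq
  rw [← coe_equiv_injective f hp, ← coe_equiv_injective f hq]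
  exact (w : P →ᵃ[ℝ] P).linearMap_vsub q' p' ▸ hC _ (ModelApartment.linear_mem_vWeyl hw) _ h

theorem coneRel_refl (hA : A ∈ S.apartments) (a : A) : S.coneRel C A a a := by
  obtain ⟨f, hf⟩ := S.isom_nonempty A hA
  obtain ⟨p, rfl⟩ := f.surjective a
  exact ⟨f, hf, p, p, rfl, rfl, vsub_self p ▸ C.zero_mem⟩

theorem coneRel.trans (hC : ∀ w ∈ D.vWeyl, ∀ v ∈ C, w v ∈ C) (hA : A ∈ S.apartments) {x y z : X}
    (hxy : S.coneRel C A x y) (hyz : S.coneRel C A y z) : S.coneRel C A x z := by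
  obtain ⟨f, hf, p, q, rfl, rfl, hpq⟩ := hxy
  obtain ⟨r, rfl⟩ : ∃ r, (f r : X) = z := by
    obtain ⟨g, -, -, r, -, rfl, -⟩ := hyz
    exact ⟨f.symm (g r), by rw [f.apply_symm_apply]⟩
  rw [coneRel_iff hC hA hf] at hyz ⊢
  exact vsub_add_vsub_cancel r q p ▸ C.add_mem hyz hpq

theorem MapsToIncreasingBrokenLine.coneRel (hC : ∀ w ∈ D.vWeyl, ∀ v ∈ C, w v ∈ C)
    (hA : A ∈ S.apartments) {ρ : X → A} {x y : X}
    (h : S.MapsToIncreasingBrokenLine A A' ρ (S.coneRel C A) x y) :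
    S.coneRel C A (ρ x) (ρ y) := by
  obtain ⟨n, z, hz, -, hstep⟩ := h
  have hz0 : ∀ i, S.coneRel C A (ρ (z 0)) (ρ (z i)) :=
    Fin.induction (coneRel_refl hA _) fun i ih => ih.trans hC hA (hstep i).2
  simpa only [hz.apply_zero, hz.apply_last] using hz0 (Fin.last n)

end ConeRel

end ApartmentSystem

namespace AffineHovel

open ApartmentSystem

variable {ι V P X : Type*} [Fintype ι] [NormedAddCommGroup V] [NormedSpace ℝ V]
  [MetricSpace P] [NormedAddTorsor V P] {D : ApartmentRootDatum ι V} {𝔸 : ModelApartment D P}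
  {S : AffineHovel 𝔸 X} {A A₁ A₂ : Set X} {R : Filter X}

theorem exists_isFacet_forall_apartment_mem (hA : A ∈ S.apartments) {x : X} (hx : x ∈ A) :
    ∃ F : Filter X, S.IsKindIn 𝔸.IsFacet A F ∧ pure x ≤ F ∧
      ∀ A' ∈ S.apartments, x ∈ A' → A' ∈ F := by
  obtain ⟨f, hf⟩ := S.isom_nonempty A hA
  obtain ⟨p, hp⟩ := f.surjective ⟨x, hx⟩
  obtain rfl : (f p : X) = x := congrArg Subtype.val hp
  obtain ⟨Fv, hFv, h0⟩ := D.exists_isVFacet_mem (Or.inl D.titsPointedCone.zero_mem)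
  refine ⟨push f (𝔸.facet p Fv), ⟨f, hf, _, ⟨p, Fv, hFv, rfl⟩, rfl⟩,
    map_mono (m := fun r => (f r : X)) (ModelApartment.pure_le_facet h0 p), fun A' hA' hx' => ?_⟩
  have hmem : A' ∈ push f (𝓟 {p}) :=
    mem_map.2 (mem_principal.2 (singleton_subset_iff.2 hx'))
  have h := (S.ma2 A hA _ (Or.inl ⟨f, hf, _, ⟨p, rfl⟩, rfl⟩) A' hA' hmem f hf).1
  rw [comap_push] at h
  exact mem_of_superset (map_mono (ModelApartment.facet_le_cl_point hFv h0 p) h) inter_subset_right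

section Germ

variable (hA : A ∈ S.apartments) (hR : S.IsKindIn 𝔸.IsFullFlaredChimneyGerm A R)

include hA hR

theorem isKind_flaredChimneyGerm : S.IsKind 𝔸.IsFlaredChimneyGerm R :=
  ⟨A, hA, hR.mono fun _ => ModelApartment.IsFullFlaredChimneyGerm.isFlaredChimneyGerm⟩

theorem exists_isIso_fixes_germ (h₁ : A₁ ∈ S.apartments) (h₁R : A₁ ∈ R) :
    ∃ φ : A₁ ≃ A, S.IsIso φ ∧ Fixes φ R := by
  have hsolid : S.IsKind 𝔸.IsSolidChimneyGerm R :=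
    ⟨A, hA, hR.mono fun _ => ModelApartment.IsFullFlaredChimneyGerm.isSolidChimneyGerm⟩
  have h := S.ma4 R R (isKind_flaredChimneyGerm hA hR) (Or.inr hsolid) A₁ h₁ h₁R h₁R A hA hR.mem
    hR.mem
  exact (sup_idem R ▸ h).exists_isIso_fixes h₁ h₁R

theorem exists_apartment_mem_germ (x : X) : ∃ A' ∈ S.apartments, A' ∈ R ∧ x ∈ A' := by
  obtain ⟨A₁, h₁, hx₁⟩ : x ∈ ⋃₀ S.apartments := S.sUnion_apartments ▸ mem_univ x
  obtain ⟨F, hF, hxF, -⟩ := exists_isFacet_forall_apartment_mem h₁ hx₁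
  obtain ⟨A', hA', hA'R, hA'F⟩ :=
    S.ma3 R F (isKind_flaredChimneyGerm hA hR) (Or.inl ⟨A₁, h₁, hF⟩)
  exact ⟨A', hA', hA'R, hxF hA'F⟩

variable [FiniteDimensional ℝ V]

theorem isIso_apply_eq_of_fixes_germ (h₁ : A₁ ∈ S.apartments) (h₁R : A₁ ∈ R)
    (h₂ : A₂ ∈ S.apartments) (h₂R : A₂ ∈ R) {x : X} (hx₁ : x ∈ A₁) (hx₂ : x ∈ A₂)
    {φ₁ : A₁ ≃ A} (hφ₁ : S.IsIso φ₁) (hφ₁R : Fixes φ₁ R) {φ₂ : A₂ ≃ A} (hφ₂ : S.IsIso φ₂)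
    (hφ₂R : Fixes φ₂ R) : φ₁ ⟨x, hx₁⟩ = φ₂ ⟨x, hx₂⟩ := by
  obtain ⟨F, hF, hxF, hFA⟩ := exists_isFacet_forall_apartment_mem h₁ hx₁
  obtain ⟨ψ, hψ, hψRF⟩ := (S.ma4 R F (isKind_flaredChimneyGerm hA hR) (Or.inl ⟨A₁, h₁, hF⟩)
    A₁ h₁ h₁R hF.mem A₂ h₂ h₂R (hFA A₂ h₂ hx₂)).exists_isIso_fixes h₁ (mem_sup.2 ⟨h₁R, hF.mem⟩)
  have hψx : ψ ⟨x, hx₁⟩ = ⟨x, hx₂⟩ := by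
    obtain ⟨T, hT, hfix⟩ := hψRF
    exact Subtype.ext (hfix ⟨x, hx₁⟩ (hxF hT.2))
  have hφψ : φ₁ = ψ.trans φ₂ := IsIso.eq_of_fixes h₁ hA hR h₁R hφ₁ hφ₁R
    (hψ.trans h₂ hA hφ₂) ((hψRF.mono le_sup_left).trans hφ₂R)
  rw [hφψ, Equiv.trans_apply, hψx]

theorem existsUnique_isRetraction : ∃! ρ : X → A, S.IsRetraction A R ρ := by
  choose B hB hBR hxB using exists_apartment_mem_germ hA hR
  choose φ hφ hφR using fun x => exists_isIso_fixes_germ hA hR (hB x) (hBR x)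
  refine ⟨fun x => φ x ⟨x, hxB x⟩, fun x => ⟨⟨B x, hB x, hBR x, hxB x, φ x, hφ x, hφR x⟩, ?_⟩,
    fun ρ hρ => funext fun x => (hρ x).2 (B x) (hB x) (hBR x) (hxB x) (φ x) (hφ x) (hφR x)⟩
  intro A' hA' hA'R hx ψ hψ hψR
  exact isIso_apply_eq_of_fixes_germ hA hR (hB x) (hBR x) hA' hA'R (hxB x) hx (hφ x) (hφR x) hψ hψR

end Germ

section Retraction

variable (hA : A ∈ S.apartments) (hR : S.IsKindIn 𝔸.IsFullFlaredChimneyGerm A R)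
  {ρ : X → A} (hρ : S.IsRetraction A R ρ) {A' : Set X} (hA' : A' ∈ S.apartments) {f : P ≃ A'}
  (hf : f ∈ S.isom A')

include hA hR hρ hA' hf

theorem exists_isom_eventually_eq_of_le_facet {G : Filter P}
    (hG : ModelApartment.IsPoint G ∨ 𝔸.IsPreorderedIntervalGerm G) {x : P} {Fv : Set V}
    (hFv : D.IsVFacet Fv) (hle : G ≤ 𝔸.facet x Fv) :
    ∃ g ∈ S.isom A, ∀ᶠ p in 𝔸.cl G, ρ (f p) = g p := by
  obtain ⟨A₁, h₁, h₁R, h₁F⟩ := S.ma3 R (push f (𝔸.facet x Fv)) (isKind_flaredChimneyGerm hA hR)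
    (Or.inl ⟨A', hA', f, hf, _, ⟨x, Fv, hFv, rfl⟩, rfl⟩)
  obtain ⟨φ, hφ, T, hT, hfix⟩ := (S.ma2 A' hA' (push f G)
    (hG.imp (fun h => ⟨f, hf, G, h, rfl⟩) fun h => Or.inl ⟨f, hf, G, h, rfl⟩)
    A₁ h₁ (map_mono hle h₁F)).exists_isIso_fixes_push_cl hf
  obtain ⟨ψ, hψ, hψR⟩ := exists_isIso_fixes_germ hA hR h₁ h₁R
  refine ⟨(f.trans φ).trans ψ, hψ.trans_mem_isom h₁ hA (hφ.trans_mem_isom hA' h₁ hf), ?_⟩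
  filter_upwards [mem_map.1 hT] with p hp
  rw [← hfix (f p) hp]
  exact (hρ _).2 A₁ h₁ h₁R (φ (f p)).2 ψ hψ hψR

variable [FiniteDimensional ℝ V]

theorem exists_isom_eventually_eq_lineMap {x y : P} (hxy : 𝔸.Le x y ∨ 𝔸.Le y x) :
    ∃ g ∈ S.isom A, ∀ᶠ s in 𝓝[≥] (0 : ℝ),
      ρ (f (AffineMap.lineMap x y s)) = g (AffineMap.lineMap x y s) := by
  have hkind : ModelApartment.IsPoint (ModelApartment.intervalGerm x y) ∨
      𝔸.IsPreorderedIntervalGerm (ModelApartment.intervalGerm x y) := by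
    rcases eq_or_ne x y with rfl | hne
    · exact Or.inl ⟨x, ModelApartment.intervalGerm_self x⟩
    · exact Or.inr ⟨x, y, hne, hxy, rfl⟩
  obtain ⟨Fv, hFv, hmem⟩ := D.exists_isVFacet_mem (v := y -ᵥ x)
    (hxy.imp_right fun h => (neg_vsub_eq_vsub_rev y x).symm ▸ h)
  obtain ⟨g, hg, h⟩ := exists_isom_eventually_eq_of_le_facet hA hR hρ hA' hf hkind hFv
    (ModelApartment.intervalGerm_le_facet hFv hmem)
  exact ⟨g, hg, (ModelApartment.tendsto_lineMap_cl_intervalGerm x y).eventually h⟩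

variable {p q : P} (hpq : 𝔸.Le p q)

include hpq

theorem exists_isom_eventually_eq_lineMap_lineMap (t r : ℝ) : ∃ g ∈ S.isom A,
    ∀ᶠ s in 𝓝[≥] (0 : ℝ), ρ (f (AffineMap.lineMap p q (AffineMap.lineMap t r s))) =
      g (AffineMap.lineMap p q (AffineMap.lineMap t r s)) := by
  have hle : ∀ {a b : ℝ}, a ≤ b → 𝔸.Le (AffineMap.lineMap p q a) (AffineMap.lineMap p q b) :=
    fun hab => lineMap_vsub_lineMap_mem (C := D.titsPointedCone) hpq hab
  simpa only [AffineMap.apply_lineMap] using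
    exists_isom_eventually_eq_lineMap hA hR hρ hA' hf ((le_total t r).imp hle hle)

theorem eventually_nhdsGE_exists_isom_eqOn (t : ℝ) : ∀ᶠ u in 𝓝[≥] t, ∃ g ∈ S.isom A,
    ∀ s ∈ Icc t u, ρ (f (AffineMap.lineMap p q s)) = g (AffineMap.lineMap p q s) := by
  obtain ⟨g, hg, h⟩ :=
    exists_isom_eventually_eq_lineMap_lineMap hA hR hρ hA' hf hpq t (t + 1)
  have hshift : Tendsto (fun s => s - t) (𝓝[≥] t) (𝓝[≥] 0) :=
    sub_self t ▸ (continuous_sub_right t).continuousWithinAt.tendsto_nhdsWithin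
      fun s (hs : t ≤ s) => sub_le_sub_right hs t
  have h' : ∀ᶠ s in 𝓝[≥] t, ρ (f (AffineMap.lineMap p q s)) = g (AffineMap.lineMap p q s) :=
    (hshift.eventually h).mono fun s hs => by
      simpa [AffineMap.lineMap_apply] using hs
  exact (((tendsto_const_pure.mono_right (pure_le_nhdsWithin self_mem_Ici)).Icc
    tendsto_id).eventually (eventually_smallSets_forall.2 h')).mono fun u hu => ⟨g, hg, hu⟩

theorem eventually_nhdsLE_exists_isom_eqOn (t : ℝ) : ∀ᶠ u in 𝓝[≤] t, ∃ g ∈ S.isom A,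
    ∀ s ∈ Icc u t, ρ (f (AffineMap.lineMap p q s)) = g (AffineMap.lineMap p q s) := by
  obtain ⟨g, hg, h⟩ :=
    exists_isom_eventually_eq_lineMap_lineMap hA hR hρ hA' hf hpq t (t - 1)
  have hshift : Tendsto (fun s => t - s) (𝓝[≤] t) (𝓝[≥] 0) :=
    sub_self t ▸ (continuous_sub_left t).continuousWithinAt.tendsto_nhdsWithin
      fun s (hs : s ≤ t) => sub_le_sub_left hs t
  have h' : ∀ᶠ s in 𝓝[≤] t, ρ (f (AffineMap.lineMap p q s)) = g (AffineMap.lineMap p q s) :=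
    (hshift.eventually h).mono fun s hs => by
      simpa [AffineMap.lineMap_apply] using hs
  exact ((tendsto_id.Icc (tendsto_const_pure.mono_right (pure_le_nhdsWithin
    self_mem_Iic))).eventually (eventually_smallSets_forall.2 h')).mono fun u hu => ⟨g, hg, hu⟩

theorem exists_subdivision_isom_eqOn :
    ∃ (n : ℕ) (τ : Fin (n + 1) → ℝ), τ 0 = 0 ∧ τ (Fin.last n) = 1 ∧
      ∀ i : Fin n, τ i.castSucc ≤ τ i.succ ∧ ∃ g ∈ S.isom A, ∀ s ∈ Icc (τ i.castSucc) (τ i.succ),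
        ρ (f (AffineMap.lineMap p q s)) = g (AffineMap.lineMap p q s) :=
  exists_fin_of_reflTransGen (reflTransGen_of_eventually
    (fun _ _ _ _ hut ⟨g, hg, h⟩ => ⟨g, hg, fun v hv => h v ⟨hv.1, hv.2.trans hut⟩⟩)
    (eventually_nhdsGE_exists_isom_eqOn hA hR hρ hA' hf hpq)
    (eventually_nhdsLE_exists_isom_eqOn hA hR hρ hA' hf hpq) zero_le_one)

end Retraction

theorem mapsToIncreasingBrokenLine_coneRel [FiniteDimensional ℝ V] (hA : A ∈ S.apartments)
    (hR : S.IsKindIn 𝔸.IsFullFlaredChimneyGerm A R) {ρ : X → A} (hρ : S.IsRetraction A R ρ)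
    {A' : Set X} (hA' : A' ∈ S.apartments) {C : PointedCone ℝ V} (hC : C ≤ D.titsPointedCone)
    {x y : X} (hxy : S.coneRel C A' x y) :
    S.MapsToIncreasingBrokenLine A A' ρ (S.coneRel C A) x y := by
  obtain ⟨f, hf, p, q, rfl, rfl, hpq⟩ := hxy
  obtain ⟨n, τ, h0, h1, hτ⟩ := exists_subdivision_isom_eqOn hA hR hρ hA' hf (hC hpq)
  have hmono : Monotone τ := Fin.monotone_iff_le_succ.2 fun i => (hτ i).1
  have hz : S.IsSubdivision A' (f p) (f q) fun i => f (AffineMap.lineMap p q (τ i)) :=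
    ⟨f, hf, p, q, rfl, rfl, τ, hmono, h0, h1, fun _ => rfl⟩
  refine hz.mapsToIncreasingBrokenLine hA' fun i => ?_
  obtain ⟨hle, g, hg, h⟩ := hτ i
  refine ⟨image_seg_of_eqOn hA hA' hf hg ?_, g, hg, AffineMap.lineMap p q (τ i.castSucc),
    AffineMap.lineMap p q (τ i.succ), congrArg Subtype.val ?_, congrArg Subtype.val ?_,
    lineMap_vsub_lineMap_mem hpq hle⟩
  · rw [affineSegment_lineMap p q hle]
    exact forall_mem_image.2 h
  · exact (h _ (left_mem_Icc.2 hle)).symm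
  · exact (h _ (right_mem_Icc.2 hle)).symm

end AffineHovel

theorem mainTheorem8 {ι V P X : Type*} [Fintype ι]
    [NormedAddCommGroup V] [NormedSpace ℝ V] [FiniteDimensional ℝ V]
    [MetricSpace P] [NormedAddTorsor V P]
    {D : ApartmentRootDatum ι V} {𝔸 : ModelApartment D P} (S : AffineHovel 𝔸 X)
    (A : Set X) (hA : A ∈ S.apartments) (R : Filter X)
    (hR : S.IsKindIn 𝔸.IsFullFlaredChimneyGerm A R) :
    (∃! ρ : X → A, S.IsRetraction A R ρ) ∧
    ∀ ρ : X → A, S.IsRetraction A R ρ →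
      ∀ A' ∈ S.apartments, ∀ x ∈ A', ∀ y ∈ A',
        (S.Le A' x y →
          S.MapsToIncreasingBrokenLine A A' ρ (S.Le A) x y ∧ S.Le A (ρ x) (ρ y)) ∧
        (S.OpenLe A' x y →
          S.MapsToIncreasingBrokenLine A A' ρ (S.OpenLe A) x y ∧ S.OpenLe A (ρ x) (ρ y)) := by
  refine ⟨AffineHovel.existsUnique_isRetraction hA hR, fun ρ hρ A' hA' x _ y _ =>
    ⟨fun hxy => ?_, fun hxy => ?_⟩⟩
  · have h := AffineHovel.mapsToIncreasingBrokenLine_coneRel hA hR hρ hA'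
      (C := D.titsPointedCone) le_rfl hxy
    exact ⟨h, h.coneRel (fun w hw v => D.map_mem_titsCone hw) hA⟩
  · have h := AffineHovel.mapsToIncreasingBrokenLine_coneRel hA hR hρ hA'
      (C := interiorPointedCone D.titsPointedCone) (interiorPointedCone_le _) hxy
    exact ⟨h, h.coneRel (fun w hw v => D.map_mem_interior_titsPointedCone hw) hA⟩
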